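/- **Setting.** For each security parameter $n$ let a distribution $\mathrm{Gen}(n)$ on keys $k$ (bit strings of length polynomially bounded in $n$) be given, and for each key a function $f_k : D_k \to \{0,1\}^*$ with $D_k \subseteq \{0,1\}^{\ell(n)}$, where $\ell$ is polynomially bounded. (The functions may have a trapdoor and be two-to-one and efficiently computable, but the statement does not need this.) A function $\epsilon:\mathbb N\to\mathbb R$ is *negligible* if $n^c\epsilon(n)\to 0$ for every $c$. The family is *claw-free* if for every probabilistic polynomial-time algorithm $\mathcal B$ there is a negligible $\epsilon$ such that for all $n$, with $k\leftarrow\mathrm{Gen}(n)$, the probability that $\mathcal B(1^n,k)$ outputs $x_0\ne x_1$ in $D_k$ with $f_k(x_0)=f_k(x_1)$ is less than $\epsilon(n)$. **Protocol.** The verifier draws $k\leftarrow\mathrm{Gen}(n)$ and sends $k$ to the prover, who answers with a string $y$. Then the verifier continues in one of two ways. (a) It requests a preimage; the prover answers with a string $x$, and the verifier accepts iff $x\in D_k$ and $f_k(x)=y$. Let $p_x$ be the acceptance probability in this case. (b) It sends a uniformly random $r\in\{0,1\}^{\ell(n)}$ and receives a string $d$; it then sends a uniformly random angle $m\in\{\pi/4,-\pi/4\}$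 and receives a bit $b$. It accepts iff $y$ has exactly two preimages $x_0, x_1$ under $f_k$, $d$ has length $\ell(n)$, and $b$ is the more likely outcome when the qubit with (unnormalized) state $(-1)^{d\cdot x_0}|r\cdot x_0\rangle+(-1)^{d\cdot x_1}|r\cdot x_1\rangle$ (read as $|r\cdot x_0\rangle$ whenever $r\cdot x_0=r\cdot x_1$) is measured in the standard basis rotated by the angle $m$ around the $Y$ axis of the Bloch sphere. Here $u\cdot v$ is the inner product mod 2. Let $p_m$ be the acceptance probability in this case. **Theorem (soundness).** Assume that the function family is claw-free. Then for every classical probabilistic polynomial-time prover there is a negligible function $\epsilon$ such that for all $n$ $$p_x(n) + 4\,p_m(n) - 4 < \epsilon(n).$$ The probabilities are over the key, the prover's coins and the verifier's random choices. The statement holds both when the algorithms (provers and claw finders alike) are uniform and when all of them may use polynomial-size advice. -/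

import Mathlib

namespace TCFProtocol

/-! ### Machine model: while-programs over binary trees, with a step count -/

/-- Data handled by the machines: finite binary trees. -/
inductive Data : Type
  | nil : Data
  | node : Data → Data → Data

namespace Data

/-- Number of vertices (leaves included) of a tree. -/
def size : Data → ℕ
  | nil => 1
  | node l r => l.size + r.size + 1

/-- Left subtree (`nil` for the empty tree). -/
def left : Data → Data
  | nil => nil
  | node l _ => l

/-- Right subtree (`nil` for the empty tree). -/
def right : Data → Data
  | nil => nil
  | node _ r => r

/-- A bit as a tree. -/
def ofBit : Bool → Data
  | false => nil
  | true => node nil nil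

/-- A tree read as a bit. -/
def toBit : Data → Bool
  | nil => false
  | node _ _ => true

/-- A bit string as a tree (a linked list of bits). -/
def ofStr : List Bool → Data
  | [] => nil
  | b :: s => node (ofBit b) (ofStr s)

/-- A tree read as a bit string; this is total and inverts `ofStr`. -/
def toStr : Data → List Bool
  | nil => []
  | node h t => h.toBit :: t.toStr

/-- The natural number `n` in unary, `1^n`. -/
def unary (n : ℕ) : Data := ofStr (List.replicate n true)

end Data

/-- Programs. Each maps a tree to a tree. -/
inductive Prog : Type
  | nil : Prog                            -- the constant `nil`
  | id : Prog                             -- copy the input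
  | left : Prog                           -- left subtree
  | right : Prog                          -- right subtree
  | pair (p q : Prog) : Prog              -- build a node from the outputs of `p` and `q`
  | seq (p q : Prog) : Prog               -- first `p`, then `q`
  | ite (c p q : Prog) : Prog             -- if `c` outputs a node then `p`, else `q`
  | loop (c p : Prog) : Prog              -- while `c` outputs a node, apply `p`

/-- `p.Runs v w t`: on input `v` the program `p` halts with output `w` in exactly `t` steps.
A primitive instruction costs the size of the data that it reads, so that the step count is
polynomially related to the running time of a Turing machine. -/
inductive Prog.Runs : Prog → Data → Data → ℕ → Prop
  | nil (v : Data) : Runs .nil v .nil v.size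
  | id (v : Data) : Runs .id v v v.size
  | left (v : Data) : Runs .left v v.left v.size
  | right (v : Data) : Runs .right v v.right v.size
  | pair {p q : Prog} {v a b : Data} {s t : ℕ} :
      Runs p v a s → Runs q v b t → Runs (.pair p q) v (.node a b) (s + t + 1)
  | seq {p q : Prog} {v a b : Data} {s t : ℕ} :
      Runs p v a s → Runs q a b t → Runs (.seq p q) v b (s + t + 1)
  | ite_node {c p q : Prog} {v a b w : Data} {s t : ℕ} :
      Runs c v (.node a b) s → Runs p v w t → Runs (.ite c p q) v w (s + t + 1)
  | ite_nil {c p q : Prog} {v w : Data} {s t : ℕ} :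
      Runs c v .nil s → Runs q v w t → Runs (.ite c p q) v w (s + t + 1)
  | loop_stop {c p : Prog} {v : Data} {s : ℕ} :
      Runs c v .nil s → Runs (.loop c p) v v (s + 1)
  | loop_step {c p : Prog} {v a b v' w : Data} {s t r : ℕ} :
      Runs c v (.node a b) s → Runs p v v' t → Runs (.loop c p) v' w r →
      Runs (.loop c p) v w (s + t + r + 1)

/-- `F` is computed by a program whose number of steps on every input is bounded by a fixed
polynomial in the size of the input. -/
def PolyTime (F : Data → Data) : Prop :=
  ∃ (p : Prog) (T : Polynomial ℕ), ∀ v : Data, ∃ t : ℕ, p.Runs v (F v) t ∧ t ≤ T.eval v.size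

/-- Whether adversaries are uniform machines, or may in addition receive advice. -/
inductive Uniformity : Type
  | uniform : Uniformity
  | nonuniform : Uniformity

/-- Admissible advice sequences: none at all for uniform machines; one arbitrary string of
polynomial size for each value of the security parameter for non-uniform machines. -/
def Uniformity.Admissible : Uniformity → (ℕ → Data) → Prop
  | .uniform, a => ∀ n, a n = Data.nil
  | .nonuniform, a => ∃ p : Polynomial ℕ, ∀ n, (a n).size ≤ p.eval n

/-- A probabilistic polynomial-time machine: a polynomial-time function which receives, besides
its input, the security parameter `1^n`, its advice (empty in the uniform case), and a random tape
whose length is a polynomial in `n`. -/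
structure PPT (u : Uniformity) where
  /-- the deterministic function of (`1^n`, advice, random tape, input) -/
  fn : Data → Data
  polyTime : PolyTime fn
  /-- length of the random tape -/
  coins : Polynomial ℕ
  /-- advice -/
  advice : ℕ → Data
  admissible : u.Admissible advice

/-- The output of the machine at security parameter `n`, with random tape `ω`, on input `v`. -/
def PPT.run {u : Uniformity} (M : PPT u) (n : ℕ) (ω : List Bool) (v : Data) : Data :=
  M.fn (.node (Data.unary n) (.node (M.advice n) (.node (Data.ofStr ω) v)))

/-! ### Probability -/

/-- A uniformly random bit string of length `l`. -/
noncomputable def randomStr (l : ℕ) : PMF (List Bool) :=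
  (PMF.uniformOfFintype (Fin l → Bool)).map List.ofFn

/-- A uniformly random bit. -/
noncomputable def randomBit : PMF Bool := PMF.uniformOfFintype Bool

/-- The probability that a random proposition is true. -/
noncomputable def Pr (g : PMF Prop) : ℝ := (g True).toReal

/-- Negligible functions: `n ^ c * ε n → 0` for every `c`. -/
def Negligible (ε : ℕ → ℝ) : Prop :=
  Asymptotics.SuperpolynomialDecay Filter.atTop (fun n : ℕ => (n : ℝ)) ε

/-! ### Function families and claw-freeness -/

/-- A keyed family of functions `f_k : D_k → {0,1}^*`, with `D_k ⊆ {0,1}^{l(n)}`, and a distribution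
on keys for each security parameter `n`. Nothing is required of the functions: neither that they
or the key distribution be efficient, nor a trapdoor, nor that they be two-to-one. -/
structure FunctionFamily where
  /-- distribution of the key at security parameter `n` -/
  gen : ℕ → PMF (List Bool)
  keyLen_le : ∃ p : Polynomial ℕ, ∀ n, ∀ k ∈ (gen n).support, k.length ≤ p.eval n
  /-- length of the inputs -/
  inLen : ℕ → ℕ
  inLen_le : ∃ p : Polynomial ℕ, ∀ n, inLen n ≤ p.eval n
  /-- domain of the function with key `k` -/
  dom : ℕ → List Bool → Set (List Bool)
  length_of_mem_dom : ∀ n k, ∀ x ∈ dom n k, x.length = inLen n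
  /-- the function with key `k` (only its values on the domain matter) -/
  f : ℕ → List Bool → List Bool → List Bool

namespace FunctionFamily

/-- The preimages of `y` under `f_k`. -/
def preimages (F : FunctionFamily) (n : ℕ) (k y : List Bool) : Set (List Bool) :=
  {x | x ∈ F.dom n k ∧ F.f n k x = y}

/-- `(x₀, x₁)` is a claw of `f_k`: two distinct inputs with the same value. -/
def IsClaw (F : FunctionFamily) (n : ℕ) (k x₀ x₁ : List Bool) : Prop :=
  x₀ ≠ x₁ ∧ x₀ ∈ F.dom n k ∧ x₁ ∈ F.dom n k ∧ F.f n k x₀ = F.f n k x₁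

/-- The claw-finding experiment: `B` receives a random key `k` and outputs a pair of strings. -/
noncomputable def clawGame (F : FunctionFamily) {u : Uniformity} (B : PPT u) (n : ℕ) :
    PMF Prop := do
  let k ← F.gen n
  let ω ← randomStr (B.coins.eval n)
  let out := B.run n ω (Data.ofStr k)
  return F.IsClaw n k out.left.toStr out.right.toStr

/-- Every probabilistic polynomial-time machine finds a claw with negligible probability only. -/
def ClawFree (F : FunctionFamily) (u : Uniformity) : Prop :=
  ∀ B : PPT u, ∃ ε : ℕ → ℝ, Negligible ε ∧ ∀ n, Pr (F.clawGame B n) < ε n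

end FunctionFamily

/-! ### The verifier -/

/-- Binary inner product of two bit strings (of the same length). -/
def dot (r x : List Bool) : Bool := (List.zipWith and r x).foldr xor false

/-- `(-1)^b`. -/
def sign (b : Bool) : ℝ := if b then -1 else 1

/-- The computational basis state `|b⟩` of a qubit. -/
def ket (b : Bool) : Bool → ℝ := fun c => if c = b then 1 else 0

/-- The (unnormalized) qubit `(-1)^(d·x₀) |r·x₀⟩ + (-1)^(d·x₁) |r·x₁⟩` of an honest prover after the
second round, up to a global phase. It is one of `|0⟩, |1⟩, |+⟩, |-⟩`. A string `d` for which the two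
terms cancel is never measured; it is treated here like any other `d` with `r·x₀ = r·x₁`, which
can only make the verifier accept more often than if it were rejected. -/
noncomputable def qubit (r d x₀ x₁ : List Bool) : Bool → ℝ :=
  if dot r x₀ = dot r x₁ then ket (dot r x₀)
  else sign (dot d x₀) • ket (dot r x₀) + sign (dot d x₁) • ket (dot r x₁)

/-- The measurement angle: `π/4` or `-π/4`. -/
noncomputable def angle (m : Bool) : ℝ := if m then Real.pi / 4 else -(Real.pi / 4)

/-- The measurement basis obtained from `|0⟩, |1⟩` by the rotation of the Bloch sphere
around the `Y` axis by the angle `θ`; `rotatedKet θ b` is the basis vector of outcome `b`. -/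
noncomputable def rotatedKet (θ : ℝ) (b : Bool) : Bool → ℝ :=
  if b then -Real.sin (θ / 2) • ket false + Real.cos (θ / 2) • ket true
  else Real.cos (θ / 2) • ket false + Real.sin (θ / 2) • ket true

/-- The (unnormalized) Born probability of the outcome `b` when the state `ψ` is measured in the
basis rotated by `θ`. -/
noncomputable def bornWeight (θ : ℝ) (ψ : Bool → ℝ) (b : Bool) : ℝ :=
  (∑ c, rotatedKet θ b c * ψ c) ^ 2

/-- The verifier's decision in the last round, on the transcript `y, r, d, m, b`: `y` has exactly two
preimages `x₀, x₁`, the string `d` has the right length, and `b` is the more likely outcome of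
the measurement at angle `±π/4` of the qubit determined by `r, d, x₀, x₁`. -/
def AcceptsCHSH (F : FunctionFamily) (n : ℕ) (k y r d : List Bool) (m b : Bool) : Prop :=
  ∃ x₀ x₁ : List Bool, x₀ ≠ x₁ ∧ F.preimages n k y = {x₀, x₁} ∧ d.length = F.inLen n ∧
    bornWeight (angle m) (qubit r d x₀ x₁) (!b) < bornWeight (angle m) (qubit r d x₀ x₁) b

/-! ### Classical provers and the two acceptance probabilities -/

/-- What the verifier has sent so far, after the key. -/
inductive Challenge : Type
  | start : Challenge                                 -- nothing yet: `y` is expected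
  | preimage : Challenge                              -- request for a preimage
  | second (r : List Bool) : Challenge                -- `r` was sent: `d` is expected
  | third (r : List Bool) (m : Bool) : Challenge      -- `r`, `m` were sent: `b` is expected

/-- Encoding of the messages received so far. -/
def Challenge.encode : Challenge → Data
  | start => .nil
  | preimage => .node .nil .nil
  | second r => .node (.node .nil .nil) (Data.ofStr r)
  | third r m => .node (.node .nil (.node .nil .nil)) (.node (Data.ofBit m) (Data.ofStr r))

/-- The reply of the classical prover `A`, with random tape `ω`, as a function of the key and of all
messages that it has received. -/
def PPT.reply {u : Uniformity} (A : PPT u) (n : ℕ) (ω k : List Bool) (c : Challenge) : Data :=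
  A.run n ω (.node (Data.ofStr k) c.encode)

/-- The protocol when the verifier asks for a preimage after the first round. -/
noncomputable def preimageGame (F : FunctionFamily) {u : Uniformity} (A : PPT u) (n : ℕ) :
    PMF Prop := do
  let k ← F.gen n
  let ω ← randomStr (A.coins.eval n)
  let y := (A.reply n ω k .start).toStr
  let x := (A.reply n ω k .preimage).toStr
  return x ∈ F.preimages n k y

/-- The protocol when the verifier continues with the second and third rounds. -/
noncomputable def chshGame (F : FunctionFamily) {u : Uniformity} (A : PPT u) (n : ℕ) :
    PMF Prop := do
  let k ← F.gen n
  let ω ← randomStr (A.coins.eval n)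
  let y := (A.reply n ω k .start).toStr
  let r ← randomStr (F.inLen n)
  let d := (A.reply n ω k (.second r)).toStr
  let m ← randomBit
  let b := (A.reply n ω k (.third r m)).toBit
  return AcceptsCHSH F n k y r d m b

/-- The acceptance probability `p_x` in the preimage case. -/
noncomputable def pX (F : FunctionFamily) {u : Uniformity} (A : PPT u) (n : ℕ) : ℝ :=
  Pr (preimageGame F A n)

/-- The acceptance probability `p_m` in the other case. -/
noncomputable def pM (F : FunctionFamily) {u : Uniformity} (A : PPT u) (n : ℕ) : ℝ :=
  Pr (chshGame F A n)

end TCFProtocol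

namespace TCFProtocol

/-! ### Closure properties of polynomial-time functions -/

/-! A classical prover can be rewound. Fix the key and the coins; then `y`, the preimage `x`, the
map from `r` to `d` and both answers to `(r, m)` are determined. Let `x, x'` be the two preimages of
`y` and `s` their sum mod 2. If `r·s = 0`, the qubit is a standard basis state and the likelier
outcome is the same for both angles. If `r·s = 1`, it is a Hadamard basis state and the likelier
outcome flips with the angle. So whenever both answers are accepted, their sum is the bit `r·s`
(`agreement_eq_one_of_acceptsCHSH`).

If `P` is the acceptance probability in case (b) for these coins, both answers are accepted for a
fraction at least `2P - 1` of the strings `r`, so the sum of the answers has correlation at least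
`4P - 3` with `r·s`. When `x` is valid, `4P - 3` is exactly the excess `1 + 4P - 4`; when `x` is
invalid, the excess is at most `0`. An excess above `θ/2` therefore lets the Goldreich-Levin
algorithm find `s`, and with it the claw `(x, x + s)`, with inverse polynomial probability
(`accept_le_claw`). Averaging over keys and coins bounds the excess by a polynomial times the
success of a claw finder, plus `θ/2` (`excess_le_claw`). With `θ = n^(-c)`, one claw finder for each
`c`, the excess is at most a negligible function plus `n^(-c)` for every `c`.

Goldreich-Levin is analysed by second moments (`avg_goldreichLevin_ge`): the samples form a randomly
translated span of few random vectors, so that only logarithmically many inner products with `s`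
must be guessed. The claw finder must also be a program of the machine model. This rests on closure
of polynomial time under folds over lists with bounded intermediate results (`PolyTime.foldl`). -/

theorem Data.size_pos (v : Data) : 0 < v.size := by
  cases v <;> simp [Data.size]

theorem Data.size_left_le (v : Data) : v.left.size ≤ v.size := by
  cases v <;> simp [Data.size, Data.left]; omega

theorem Data.size_right_le (v : Data) : v.right.size ≤ v.size := by
  cases v <;> simp [Data.size, Data.right]; omega

theorem natPolynomial_eval_mono (P : Polynomial ℕ) : Monotone fun n => P.eval n := by
  induction P using Polynomial.induction_on' with
  | add p q hp hq =>
    intro a b h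
    simp only [Polynomial.eval_add]
    exact Nat.add_le_add (hp h) (hq h)
  | monomial n c =>
    intro a b h
    simp only [Polynomial.eval_monomial]
    gcongr

/-- A machine spends at least as many steps as its input and its output have vertices. -/
theorem Prog.Runs.size_le {p : Prog} {v w : Data} {t : ℕ} (h : p.Runs v w t) :
    v.size ≤ t ∧ w.size ≤ t := by
  induction h with
  | nil v => exact ⟨le_rfl, v.size_pos⟩
  | id v => exact ⟨le_rfl, le_rfl⟩
  | left v => exact ⟨le_rfl, v.size_left_le⟩
  | right v => exact ⟨le_rfl, v.size_right_le⟩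
  | pair _ _ h₁ h₂ => simp only [Data.size]; omega
  | seq _ _ h₁ h₂ => omega
  | ite_node _ _ h₁ h₂ => omega
  | ite_nil _ _ h₁ h₂ => omega
  | loop_stop _ h => omega
  | loop_step _ _ _ h₁ h₂ h₃ => omega

theorem PolyTime.size_le {F : Data → Data} (hF : PolyTime F) :
    ∃ T : Polynomial ℕ, ∀ v, (F v).size ≤ T.eval v.size := by
  obtain ⟨p, T, h⟩ := hF
  refine ⟨T, fun v => ?_⟩
  obtain ⟨t, ht, hT⟩ := h v
  exact ht.size_le.2.trans hT

theorem polyTime_nil : PolyTime fun _ => Data.nil :=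
  ⟨.nil, Polynomial.X, fun v => ⟨_, .nil v, by simp⟩⟩

theorem polyTime_id : PolyTime fun v => v :=
  ⟨.id, Polynomial.X, fun v => ⟨_, .id v, by simp⟩⟩

theorem polyTime_left : PolyTime Data.left :=
  ⟨.left, Polynomial.X, fun v => ⟨_, .left v, by simp⟩⟩

theorem polyTime_right : PolyTime Data.right :=
  ⟨.right, Polynomial.X, fun v => ⟨_, .right v, by simp⟩⟩

theorem PolyTime.node {F G : Data → Data} (hF : PolyTime F) (hG : PolyTime G) :
    PolyTime fun v => .node (F v) (G v) := by
  obtain ⟨p, S, hp⟩ := hF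
  obtain ⟨q, T, hq⟩ := hG
  refine ⟨.pair p q, S + T + 1, fun v => ?_⟩
  obtain ⟨s, hs, hS⟩ := hp v
  obtain ⟨t, ht, hT⟩ := hq v
  refine ⟨_, .pair hs ht, ?_⟩
  simp only [Polynomial.eval_add, Polynomial.eval_one]
  omega

theorem PolyTime.comp {F G : Data → Data} (hG : PolyTime G) (hF : PolyTime F) :
    PolyTime fun v => G (F v) := by
  obtain ⟨p, S, hp⟩ := hF
  obtain ⟨q, T, hq⟩ := hG
  refine ⟨.seq p q, S + T.comp S + 1, fun v => ?_⟩
  obtain ⟨s, hs, hS⟩ := hp v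
  obtain ⟨t, ht, hT⟩ := hq (F v)
  refine ⟨_, .seq hs ht, ?_⟩
  have := natPolynomial_eval_mono T (hs.size_le.2.trans hS)
  simp only [Polynomial.eval_add, Polynomial.eval_one, Polynomial.eval_comp] at this ⊢
  omega

theorem PolyTime.ite {C F G : Data → Data} (hC : PolyTime C) (hF : PolyTime F)
    (hG : PolyTime G) : PolyTime fun v => if (C v).toBit then F v else G v := by
  obtain ⟨c, R, hc⟩ := hC
  obtain ⟨p, S, hp⟩ := hF
  obtain ⟨q, T, hq⟩ := hG
  refine ⟨.ite c p q, R + S + T + 1, fun v => ?_⟩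
  obtain ⟨r, hr, hR⟩ := hc v
  obtain ⟨s, hs, hS⟩ := hp v
  obtain ⟨t, ht, hT⟩ := hq v
  simp only [Polynomial.eval_add, Polynomial.eval_one]
  cases h : C v with
  | nil => exact ⟨_, .ite_nil (h ▸ hr) ht, by omega⟩
  | node a b => exact ⟨_, .ite_node (h ▸ hr) hs, by omega⟩

/-! ### Folds over lists in the machine model -/

/-- A list of trees as a tree. -/
def Data.ofList : List Data → Data
  | [] => .nil
  | a :: l => .node a (ofList l)

/-- A tree as the list of the trees that hang off its right spine. -/
def Data.toList : Data → List Data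
  | .nil => []
  | .node a v => a :: v.toList

theorem Data.ofList_toList (v : Data) : Data.ofList v.toList = v := by
  induction v with
  | nil => rfl
  | node a v _ ih => simp [Data.toList, Data.ofList, ih]

theorem Data.toList_ofList (l : List Data) : (Data.ofList l).toList = l := by
  induction l with
  | nil => rfl
  | cons a l ih => simp [Data.toList, Data.ofList, ih]

theorem Data.length_lt_size_ofList (l : List Data) : l.length < (Data.ofList l).size := by
  induction l with
  | nil => simp [Data.ofList, Data.size]
  | cons a l ih => simp only [List.length_cons, Data.ofList, Data.size]; omega

/-- The state of the loop is (remaining list, (environment `e`, accumulator)), and the test `.left`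
fails exactly when the list is used up. Since `B` bounds every intermediate accumulator, `M` bounds
every state, so that each round costs at most `M + T(M) + 1`. -/
theorem Prog.runs_loop_foldl {p : Prog} {T : Polynomial ℕ} {S : Data → Data} {e : Data} {B : ℕ}
    (hp : ∀ a l s, ∃ t, p.Runs (.node (.node a l) (.node e s))
      (.node l (.node e (S (.node e (.node s a))))) t ∧
        t ≤ T.eval (Data.node (.node a l) (.node e s)).size)
    (l : List Data) (s : Data)
    (hB : ∀ l', l' <+: l → (l'.foldl (fun s a => S (.node e (.node s a))) s).size ≤ B)
    (M : ℕ) (hM : (Data.ofList l).size + e.size + B + 2 ≤ M) :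
    ∃ t, (Prog.loop .left p).Runs (.node (Data.ofList l) (.node e s))
      (.node .nil (.node e (l.foldl (fun s a => S (.node e (.node s a))) s))) t ∧
        t ≤ (l.length + 1) * (M + T.eval M + 1) := by
  induction l generalizing s with
  | nil =>
    have h := hB [] List.nil_prefix
    refine ⟨_, Prog.Runs.loop_stop (Prog.Runs.left _), ?_⟩
    simp only [List.foldl_nil, Data.ofList, Data.size] at h hM ⊢
    simp
    omega
  | cons a l ih =>
    have h := hB [] List.nil_prefix
    simp only [List.foldl_nil, Data.ofList, Data.size] at h hM
    obtain ⟨t, ht, hT⟩ := hp a (Data.ofList l) s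
    obtain ⟨r, hr, hR⟩ := ih (S (.node e (.node s a)))
      (fun l' hl' => hB (a :: l') ((List.prefix_cons_inj a).2 hl')) (by omega)
    have hsz : (Data.node (.node a (Data.ofList l)) (.node e s)).size ≤ M := by
      simp only [Data.size]; omega
    have hT' : t ≤ T.eval M := hT.trans (natPolynomial_eval_mono T hsz)
    have hl : (Prog.left).Runs (.node (Data.ofList (a :: l)) (.node e s))
      (.node a (Data.ofList l)) _ := Prog.Runs.left _
    refine ⟨_, .loop_step hl ht hr, ?_⟩
    change (Data.node (.node a (Data.ofList l)) (.node e s)).size + t + r + 1 ≤ _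
    rw [List.length_cons, add_mul (l.length + 1), one_mul]
    omega

/-- Folding a polynomial-time function over a list is polynomial-time if all intermediate results
have polynomially bounded size. -/
theorem PolyTime.foldl {S A I : Data → Data} (hS : PolyTime S) (hA : PolyTime A) (hI : PolyTime I)
    (B : Polynomial ℕ)
    (hB : ∀ v l', l' <+: (A v).toList →
      (l'.foldl (fun s a => S (.node v (.node s a))) (I v)).size ≤ B.eval v.size) :
    PolyTime fun v => (A v).toList.foldl (fun s a => S (.node v (.node s a))) (I v) := by
  have hbody : PolyTime fun w => .node w.left.right (.node w.right.left
      (S (.node w.right.left (.node w.right.right w.left.left)))) :=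
    have l := polyTime_left
    have r := polyTime_right
    .node (r.comp l) (.node (l.comp r) (hS.comp (.node (l.comp r) (.node (r.comp r) (l.comp l)))))
  obtain ⟨p, T, hp⟩ := hbody
  have hinit : PolyTime fun v => .node (A v) (.node v (I v)) := .node hA (.node polyTime_id hI)
  obtain ⟨TA, hTA⟩ := hA.size_le
  have hloop : ∃ (q : Prog) (R : Polynomial ℕ), ∀ v, ∃ t,
      q.Runs v (.node .nil (.node v
        ((A v).toList.foldl (fun s a => S (.node v (.node s a))) (I v)))) t ∧
      t ≤ R.eval v.size := by
    obtain ⟨i, U, hi⟩ := hinit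
    let M : Polynomial ℕ := TA + Polynomial.X + B + 2
    refine ⟨.seq i (.loop .left p), U + (TA + 1) * (M + T.comp M + 1) + 1, fun v => ?_⟩
    obtain ⟨s, hs, hU⟩ := hi v
    obtain ⟨t, ht, hT⟩ := Prog.runs_loop_foldl (p := p) (T := T) (S := S) (e := v)
      (B := B.eval v.size) (fun a l s => hp _) (A v).toList (I v) (hB v) (M.eval v.size)
      (by
        have := hTA v
        simp only [M, Data.ofList_toList, Polynomial.eval_add, Polynomial.eval_X,
          Polynomial.eval_ofNat]
        omega)
    rw [Data.ofList_toList] at ht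
    refine ⟨_, .seq hs ht, ?_⟩
    have hlen : (A v).toList.length + 1 ≤ TA.eval v.size + 1 := by
      have := Data.length_lt_size_ofList (A v).toList
      rw [Data.ofList_toList] at this
      have := hTA v
      omega
    have := Nat.mul_le_mul_right (M.eval v.size + T.eval (M.eval v.size) + 1) hlen
    simp only [Polynomial.eval_add, Polynomial.eval_mul, Polynomial.eval_one, Polynomial.eval_comp]
    omega
  obtain ⟨q, R, hq⟩ := hloop
  have : PolyTime fun v => .node .nil (.node v
        ((A v).toList.foldl (fun s a => S (.node v (.node s a))) (I v))) := ⟨q, R, hq⟩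
  exact polyTime_right.comp (polyTime_right.comp this)

theorem Data.size_lt_of_mem_toList {v a : Data} (h : a ∈ v.toList) : a.size < v.size := by
  induction v with
  | nil => simp [toList] at h
  | node b v _ ih =>
    rcases List.mem_cons.1 h with rfl | h
    · simp only [size]; omega
    · have := ih h
      simp only [size]; omega

theorem Data.length_toList_lt (v : Data) : v.toList.length < v.size := by
  simpa [ofList_toList] using length_lt_size_ofList v.toList

/-- Folding a polynomial-time function whose results exceed the accumulator by a polynomially
bounded amount only. -/
theorem PolyTime.foldl_of_size_le_add {S A I : Data → Data} (hS : PolyTime S) (hA : PolyTime A)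
    (hI : PolyTime I) (q : Polynomial ℕ)
    (hq : ∀ v s a, (S (.node v (.node s a))).size ≤ s.size + q.eval (v.size + a.size)) :
    PolyTime fun v => (A v).toList.foldl (fun s a => S (.node v (.node s a))) (I v) := by
  obtain ⟨TA, hTA⟩ := hA.size_le
  obtain ⟨TI, hTI⟩ := hI.size_le
  refine hS.foldl hA hI (TI + TA * q.comp (Polynomial.X + TA)) fun v l' hl' => ?_
  have key : ∀ l : List Data, (∀ a ∈ l, a.size ≤ TA.eval v.size) → ∀ s,
      (l.foldl (fun s a => S (.node v (.node s a))) s).size ≤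
        s.size + l.length * q.eval (v.size + TA.eval v.size) := by
    intro l
    induction l with
    | nil => simp
    | cons a l ih =>
      intro h s
      have h₁ := ih (fun b hb => h b (List.mem_cons_of_mem _ hb)) (S (.node v (.node s a)))
      have h₂ := hq v s a
      have h₃ := natPolynomial_eval_mono q (Nat.add_le_add_left (h a List.mem_cons_self) v.size)
      simp only [List.foldl_cons, List.length_cons, add_mul, one_mul] at h₁ h₃ ⊢
      omega
  have h₁ := key l' (fun a ha =>
    (Data.size_lt_of_mem_toList (hl'.subset ha)).le.trans (hTA v)) (I v)
  have h₂ : l'.length ≤ TA.eval v.size :=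
    hl'.length_le.trans ((A v).length_toList_lt.le.trans (hTA v))
  have h₃ := Nat.mul_le_mul_right (q.eval (v.size + TA.eval v.size)) h₂
  have h₄ := hTI v
  simp only [Polynomial.eval_add, Polynomial.eval_mul, Polynomial.eval_X, Polynomial.eval_comp]
  omega

theorem foldl_cons_eq_map_reverse {α β : Type*} (f : α → β) (l : List α) (s : List β) :
    l.foldl (fun s a => f a :: s) s = (l.map f).reverse ++ s := by
  induction l generalizing s with
  | nil => rfl
  | cons a l ih => simp [ih]

theorem Data.foldl_node (f : Data → Data) (l s : List Data) :
    l.foldl (fun s a => Data.node (f a) s) (ofList s) = ofList (l.foldl (fun s a => f a :: s) s) := by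
  induction l generalizing s with
  | nil => rfl
  | cons a l ih => exact ih (f a :: s)

theorem PolyTime.map_reverse {G : Data → Data} (hG : PolyTime G) :
    PolyTime fun v => Data.ofList (v.toList.map G).reverse := by
  obtain ⟨q, hq⟩ := hG.size_le
  have := PolyTime.foldl_of_size_le_add (S := fun w => .node (G w.right.right) w.right.left)
    (.node (hG.comp (polyTime_right.comp polyTime_right)) (polyTime_left.comp polyTime_right))
    polyTime_id polyTime_nil (q + 1) (fun v s a => by
      have h₁ := hq a
      have h₂ := natPolynomial_eval_mono q (Nat.le_add_left a.size v.size)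
      simp only [Data.size, Data.left, Data.right, Polynomial.eval_add, Polynomial.eval_one] at h₂ ⊢
      omega)
  convert this using 2 with v
  have := Data.foldl_node G v.toList []
  simp only [foldl_cons_eq_map_reverse, List.append_nil] at this
  exact this.symm

theorem PolyTime.map {G : Data → Data} (hG : PolyTime G) :
    PolyTime fun v => Data.ofList (v.toList.map G) := by
  -- Mapping the identity reverses the list a second time.
  have := polyTime_id.map_reverse.comp hG.map_reverse
  simpa [Data.toList_ofList, Function.comp_def] using this

/-! ### Polynomial time for functions between encoded types -/

/-- Types whose elements are encoded as trees. Every tree is read as some element, and the tree can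
be replaced by the encoding of that element in polynomial time. -/
class Enc (α : Type) where
  enc : α → Data
  dec : Data → α
  dec_enc : ∀ a, dec (enc a) = a
  polyTime_enc_dec : PolyTime fun v => enc (dec v)

open Enc

attribute [simp] Enc.dec_enc

instance : Enc Data := ⟨fun v => v, fun v => v, fun _ => rfl, polyTime_id⟩

instance : Enc Bool where
  enc := Data.ofBit
  dec := Data.toBit
  dec_enc b := by cases b <;> rfl
  polyTime_enc_dec := by
    have := PolyTime.ite polyTime_id (polyTime_nil.node polyTime_nil) polyTime_nil
    convert this using 2 with v
    cases v <;> rfl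

instance {α β : Type} [Enc α] [Enc β] : Enc (α × β) where
  enc a := .node (enc a.1) (enc a.2)
  dec v := (dec v.left, dec v.right)
  dec_enc a := by simp [Data.left, Data.right]
  polyTime_enc_dec :=
    .node (polyTime_enc_dec.comp polyTime_left) (polyTime_enc_dec.comp polyTime_right)

instance {α : Type} [Enc α] : Enc (List α) where
  enc l := Data.ofList (l.map enc)
  dec v := v.toList.map dec
  dec_enc l := by simp [Data.toList_ofList, Function.comp_def]
  polyTime_enc_dec := by
    have := PolyTime.map (polyTime_enc_dec (α := α))
    simpa [Function.comp_def] using this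

theorem enc_str (s : List Bool) : enc s = Data.ofStr s := by
  induction s with
  | nil => rfl
  | cons b s ih => exact congrArg (Data.node (Data.ofBit b)) ih

theorem dec_str (v : Data) : (dec v : List Bool) = v.toStr := by
  induction v with
  | nil => rfl
  | node a v _ ih => exact congrArg (List.cons a.toBit) ih

/-- Size of the encoding. -/
def esize {α : Type} [Enc α] (a : α) : ℕ := (enc a).size

/-- `f` is polynomial-time as a function of the encodings. -/
def PT {α β : Type} [Enc α] [Enc β] (f : α → β) : Prop :=
  PolyTime fun v => enc (f (dec v))

/-- `f` is bounded by a polynomial in the size of the encoding. -/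
def PolyBdd {α : Type} [Enc α] (f : α → ℕ) : Prop :=
  ∃ q : Polynomial ℕ, ∀ a, f a ≤ q.eval (esize a)

section

variable {α β γ σ : Type} [Enc α] [Enc β] [Enc γ] [Enc σ]

theorem esize_pos (a : α) : 0 < esize a := Data.size_pos _

theorem esize_pair (a : α) (b : β) : esize (a, b) = esize a + esize b + 1 := rfl

theorem esize_nil : esize ([] : List α) = 1 := rfl

theorem esize_cons (a : α) (l : List α) : esize (a :: l) = esize a + esize l + 1 := rfl

theorem length_lt_esize (l : List α) : l.length < esize l := by
  rw [← List.length_map (f := enc)]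
  exact Data.length_lt_size_ofList (l.map enc)

theorem esize_lt_of_mem {a : α} {l : List α} (h : a ∈ l) : esize a < esize l :=
  Data.size_lt_of_mem_toList (by
    simpa [enc, Data.toList_ofList] using ⟨a, h, rfl⟩)

theorem esize_bool_le (b : Bool) : esize b ≤ 3 := by cases b <;> decide

theorem esize_list_le {l : List α} {B : ℕ} (h : ∀ a ∈ l, esize a ≤ B) :
    esize l ≤ l.length * (B + 1) + 1 := by
  induction l with
  | nil => simp [esize_nil]
  | cons a l ih =>
    have h₁ := ih fun b hb => h b (List.mem_cons_of_mem _ hb)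
    have h₂ := h a List.mem_cons_self
    rw [esize_cons, List.length_cons, add_mul, one_mul]
    omega

theorem esize_str_le (s : List Bool) : esize s ≤ s.length * 4 + 1 :=
  esize_list_le fun b _ => esize_bool_le b

theorem PolyBdd.mono {f g : α → ℕ} (hg : PolyBdd g) (h : ∀ a, f a ≤ g a) : PolyBdd f := by
  obtain ⟨q, hq⟩ := hg
  exact ⟨q, fun a => (h a).trans (hq a)⟩

theorem PolyBdd.const (c : ℕ) : PolyBdd fun _ : α => c := ⟨Polynomial.C c, by simp⟩

theorem PolyBdd.add {f g : α → ℕ} (hf : PolyBdd f) (hg : PolyBdd g) :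
    PolyBdd fun a => f a + g a := by
  obtain ⟨p, hp⟩ := hf
  obtain ⟨q, hq⟩ := hg
  exact ⟨p + q, fun a => by simpa using Nat.add_le_add (hp a) (hq a)⟩

theorem PolyBdd.mul {f g : α → ℕ} (hf : PolyBdd f) (hg : PolyBdd g) :
    PolyBdd fun a => f a * g a := by
  obtain ⟨p, hp⟩ := hf
  obtain ⟨q, hq⟩ := hg
  exact ⟨p * q, fun a => by simpa using Nat.mul_le_mul (hp a) (hq a)⟩

theorem PolyBdd.eval {f : α → ℕ} (hf : PolyBdd f) (P : Polynomial ℕ) :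
    PolyBdd fun a => P.eval (f a) := by
  obtain ⟨p, hp⟩ := hf
  exact ⟨P.comp p, fun a => by simpa using natPolynomial_eval_mono P (hp a)⟩

theorem PT.polyBdd {f : α → β} (hf : PT f) : PolyBdd fun a => esize (f a) := by
  obtain ⟨q, hq⟩ := hf.size_le
  exact ⟨q, fun a => by simpa [esize] using hq (enc a)⟩

theorem PT.polyBdd_length {f : α → List β} (hf : PT f) : PolyBdd fun a => (f a).length :=
  hf.polyBdd.mono fun _ => (length_lt_esize _).le

theorem PT.id : PT fun a : α => a := polyTime_enc_dec

theorem PT.comp {g : β → γ} {f : α → β} (hg : PT g) (hf : PT f) : PT fun a => g (f a) := by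
  have := PolyTime.comp hg hf
  simpa [PT] using this

theorem PT.of_polyTime {F : Data → Data} (hF : PolyTime F) : PT F := hF

theorem polyTime_const (w : Data) : PolyTime fun _ => w := by
  induction w with
  | nil => exact polyTime_nil
  | node a b ha hb => exact ha.node hb

theorem PT.const (b : β) : PT fun _ : α => b := polyTime_const _

theorem PT.pair {f : α → β} {g : α → γ} (hf : PT f) (hg : PT g) : PT fun a => (f a, g a) :=
  PolyTime.node hf hg

theorem PT.fst {f : α → β × γ} (hf : PT f) : PT fun a => (f a).1 :=
  polyTime_left.comp hf

theorem PT.snd {f : α → β × γ} (hf : PT f) : PT fun a => (f a).2 :=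
  polyTime_right.comp hf

theorem PT.enc {f : α → β} (hf : PT f) : PT fun a => Enc.enc (f a) := hf

theorem PT.dec {f : α → Data} (hf : PT f) : PT fun a => (Enc.dec (f a) : β) :=
  polyTime_enc_dec.comp hf

theorem PT.ite {c : α → Bool} {f g : α → β} (hc : PT c) (hf : PT f) (hg : PT g) :
    PT fun a => if c a then f a else g a := by
  have := PolyTime.ite hc hf hg
  unfold PT
  convert this using 2 with v
  beta_reduce
  generalize c (Enc.dec v) = b
  cases b <;> rfl

theorem PT.not {f : α → Bool} (hf : PT f) : PT fun a => !f a := by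
  have := hf.ite (PT.const (α := α) false) (PT.const true)
  convert this using 2 with a
  cases f a <;> rfl

theorem PT.xor {f g : α → Bool} (hf : PT f) (hg : PT g) : PT fun a => xor (f a) (g a) := by
  have := hf.ite hg.not hg
  convert this using 2 with a
  cases f a <;> cases g a <;> rfl

theorem PT.cons {f : α → β} {g : α → List β} (hf : PT f) (hg : PT g) : PT fun a => f a :: g a :=
  PolyTime.node hf hg

theorem PT.tail {f : α → List β} (hf : PT f) : PT fun a => (f a).tail := by
  have := polyTime_right.comp hf
  unfold PT
  convert this using 2 with v
  beta_reduce
  generalize f (Enc.dec v) = b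
  cases b <;> rfl

theorem PT.headD {f : α → List Bool} (hf : PT f) : PT fun a => (f a).headD false := by
  have := polyTime_left.comp hf
  unfold PT
  convert this using 2 with v
  beta_reduce
  generalize f (Enc.dec v) = b
  cases b <;> rfl

theorem PT.isEmpty {f : α → List β} (hf : PT f) : PT fun a => (f a).isEmpty := by
  have := PolyTime.ite hf (polyTime_const (Data.ofBit false)) (polyTime_const (Data.ofBit true))
  unfold PT
  convert this using 2 with v
  beta_reduce
  generalize f (Enc.dec v) = b
  cases b <;> rfl

/-- Since `dec` inverts `enc`, folding on encodings commutes with encoding. The environment remains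
the raw input tree and is decoded anew in each round; its re-encoding may be larger, hence the bound
`q.comp T`. -/
theorem PT.foldl {l : α → List β} {s : α → σ} {f : α → σ → β → σ} {B : α → ℕ}
    (hf : PT fun q : α × σ × β => f q.1 q.2.1 q.2.2) (hl : PT l) (hs : PT s) (hB : PolyBdd B)
    (h : ∀ a l', l' <+: l a → esize (l'.foldl (f a) (s a)) ≤ B a) :
    PT fun a => (l a).foldl (f a) (s a) := by
  obtain ⟨q, hq⟩ := hB
  obtain ⟨T, hT⟩ := (polyTime_enc_dec (α := α)).size_le
  have key : ∀ v (l : List β) (s : σ), (l.map Enc.enc).foldl (fun s a =>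
      Enc.enc ((fun q : α × σ × β => f q.1 q.2.1 q.2.2) (Enc.dec (.node v (.node s a)))))
        (Enc.enc s) = Enc.enc (l.foldl (f (Enc.dec v)) s) := by
    intro v l
    induction l with
    | nil => intro s; rfl
    | cons b l ih =>
      intro s
      rw [List.map_cons, List.foldl_cons, List.foldl_cons, ← ih]
      simp [Enc.dec, Data.left, Data.right]
  have := PolyTime.foldl hf hl hs (q.comp T) (fun v l' hl' => by
    have hm : (Enc.enc (l (Enc.dec v))).toList = (l (Enc.dec v)).map Enc.enc :=
      Data.toList_ofList _
    rw [hm] at hl'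
    obtain ⟨l'', h₁, rfl⟩ := List.prefix_map_iff.1 hl'
    rw [key, Polynomial.eval_comp]
    exact ((h _ _ h₁).trans (hq _)).trans (natPolynomial_eval_mono q (hT v)))
  unfold PT
  convert this using 2 with v
  have hm : (Enc.enc (l (Enc.dec v))).toList = (l (Enc.dec v)).map Enc.enc :=
      Data.toList_ofList _
  rw [hm, key]

end

/-! ### Polynomial-time list functions -/

section

variable {α β γ σ : Type} [Enc α] [Enc β] [Enc γ] [Enc σ]

theorem PT.foldl_of_esize_le_add {l : α → List β} {s : α → σ} {f : α → σ → β → σ}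
    (hf : PT fun q : α × σ × β => f q.1 q.2.1 q.2.2) (hl : PT l) (hs : PT s) (q : Polynomial ℕ)
    (hq : ∀ a s b, esize (f a s b) ≤ esize s + q.eval (esize a + esize b)) :
    PT fun a => (l a).foldl (f a) (s a) := by
  refine hf.foldl hl hs (B := fun a => esize (s a) +
    (l a).length * q.eval (esize a + esize (l a))) ?_ fun a l' hl' => ?_
  · exact hs.polyBdd.add (hl.polyBdd_length.mul ((PT.id.polyBdd.add hl.polyBdd).eval q))
  · have key : ∀ (l' : List β) s, (∀ b ∈ l', esize b ≤ esize (l a)) →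
        esize (l'.foldl (f a) s) ≤ esize s + l'.length * q.eval (esize a + esize (l a)) := by
      intro l'
      induction l' with
      | nil => simp
      | cons b l' ih =>
        intro s h
        have h₁ := ih (f a s b) fun c hc => h c (List.mem_cons_of_mem _ hc)
        have h₂ := natPolynomial_eval_mono q
          (Nat.add_le_add_left (h b List.mem_cons_self) (esize a))
        have h₃ := hq a s b
        simp only [List.foldl_cons, List.length_cons, add_mul, one_mul] at h₁ h₂ ⊢
        omega
    have h₁ := key l' (s a) fun b hb => (esize_lt_of_mem (hl'.subset hb)).le
    have h₂ := Nat.mul_le_mul_right (q.eval (esize a + esize (l a))) hl'.length_le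
    omega

theorem PT.reverse {l : α → List β} (hl : PT l) : PT fun a => (l a).reverse := by
  have := PT.foldl_of_esize_le_add (f := fun (_ : α) (s : List β) b => b :: s)
    (PT.cons (PT.snd (PT.snd PT.id)) (PT.fst (PT.snd PT.id))) hl (PT.const []) (Polynomial.X + 1)
    (fun a s b => by
      simp only [esize_cons, Polynomial.eval_add, Polynomial.eval_X, Polynomial.eval_one]
      omega)
  simpa [foldl_cons_eq_map_reverse (fun b => b)] using this

theorem PT.append {l l' : α → List β} (hl : PT l) (hl' : PT l') : PT fun a => l a ++ l' a := by
  have := PT.foldl_of_esize_le_add (f := fun (_ : α) (s : List β) b => b :: s)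
    (PT.cons (PT.snd (PT.snd PT.id)) (PT.fst (PT.snd PT.id))) hl.reverse hl' (Polynomial.X + 1)
    (fun a s b => by
      simp only [esize_cons, Polynomial.eval_add, Polynomial.eval_X, Polynomial.eval_one]
      omega)
  simpa [foldl_cons_eq_map_reverse (fun b => b)] using this

theorem PT.map {f : α → β → γ} {l : α → List β} (hf : PT fun q : α × β => f q.1 q.2) (hl : PT l) :
    PT fun a => (l a).map (f a) := by
  obtain ⟨q, hq⟩ := hf.polyBdd
  have := PT.foldl_of_esize_le_add (f := fun (a : α) (s : List γ) b => f a b :: s)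
    (PT.cons (hf.comp (PT.pair (PT.fst PT.id) (PT.snd (PT.snd PT.id)))) (PT.fst (PT.snd PT.id)))
    hl (PT.const []) (q.comp (Polynomial.X + 1) + 1)
    (fun a s b => by
      have := hq (a, b)
      simp only [esize_cons, esize_pair, Polynomial.eval_add, Polynomial.eval_X,
        Polynomial.eval_one, Polynomial.eval_comp] at this ⊢
      omega)
  simpa [foldl_cons_eq_map_reverse] using this.reverse

theorem esize_append (l l' : List α) : esize (l ++ l') + 1 = esize l + esize l' := by
  induction l with
  | nil => simp [esize_nil]; omega
  | cons a l ih => simp only [List.cons_append, esize_cons]; omega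

theorem esize_tail_le (l : List α) : esize l.tail ≤ esize l := by
  cases l with
  | nil => rfl
  | cons a l => rw [List.tail_cons, esize_cons]; omega

/-- Numbers are handled as lengths of lists: here `l'` serves as a unary counter, with one `tail`
for each of its entries. -/
theorem PT.drop {l : α → List β} {l' : α → List γ} (hl : PT l) (hl' : PT l') :
    PT fun a => (l a).drop (l' a).length := by
  have := PT.foldl_of_esize_le_add (f := fun (_ : α) (s : List β) (_ : γ) => s.tail)
    (PT.tail (PT.fst (PT.snd PT.id))) hl' hl 0
    (fun a s b => by simpa using esize_tail_le s)
  convert this using 2 with a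
  generalize l a = s
  generalize l' a = t
  induction t generalizing s with
  | nil => rfl
  | cons b t ih => rw [List.foldl_cons, ← ih, List.length_cons, List.drop_tail, add_comm]

theorem PT.length_lt {l : α → List β} {l' : α → List γ} (hl : PT l) (hl' : PT l') :
    PT fun a => decide ((l a).length < (l' a).length) := by
  have := (hl'.drop hl).isEmpty.not
  convert this using 2 with a
  rw [Bool.eq_iff_iff]
  simp

theorem PT.replicate_eval {l : α → List Bool} (hl : PT l) (P : Polynomial ℕ) :
    PT fun a => List.replicate (P.eval (l a).length) true := by
  induction P using Polynomial.induction_on with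
  | C c => simpa only [Polynomial.eval_C] using PT.const (List.replicate c true)
  | add p q hp hq => simpa only [Polynomial.eval_add, List.replicate_add] using hp.append hq
  | monomial n c ih =>
    -- Raising the degree by one multiplies by the length of `l`: the list for the lower degree,
    -- carried as `a.2`, is appended once for each entry of `l`.
    have := PT.foldl_of_esize_le_add (α := α × List Bool) (l := fun a => l a.1)
      (s := fun _ => ([] : List Bool)) (f := fun a s (_ : Bool) => s ++ a.2)
      (PT.append (PT.fst (PT.snd PT.id)) (PT.snd (PT.fst PT.id))) (hl.comp (PT.fst PT.id))
      (PT.const []) Polynomial.X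
      (fun a s b => by
        have h₁ := esize_append s a.2
        have h₂ := esize_pair a.1 a.2
        simp only [Prod.mk.eta, Polynomial.eval_X] at h₂ ⊢
        omega)
    have := this.comp (PT.pair PT.id ih)
    convert this using 2 with a
    dsimp only
    have key : ∀ (t : List Bool) (m k : ℕ), t.foldl (fun s _ => s ++ List.replicate m true)
        (List.replicate k true) = List.replicate (k + t.length * m) true := by
      intro t m
      induction t with
      | nil => simp
      | cons b t ih =>
        intro k
        rw [List.foldl_cons, List.replicate_append_replicate, ih, List.length_cons]
        congr 1
        ring
    have := key (l a) (Polynomial.eval (l a).length (Polynomial.C c * Polynomial.X ^ n)) 0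
    rw [List.replicate_zero] at this
    rw [this]
    congr 1
    simp
    ring

end

/-! ### Bit vectors -/

/-- Bitwise sum of `v` and `w`, with the length of `v`: the string `w` is cut or padded by zeros. -/
def vxor : List Bool → List Bool → List Bool
  | [], _ => []
  | b :: v, w => xor b (w.headD false) :: vxor v w.tail

/-- The zero vector with as many entries as `x`. -/
def vzero (x : List Bool) : List Bool := x.map fun _ => false

/-- One step in the construction of the list of unit vectors. -/
def unitVecStep (E : List (List Bool)) : List (List Bool) :=
  (true :: E.map fun _ => false) :: E.map (List.cons false)

/-- The standard basis of `n`-bit vectors. -/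
def unitVecs (n : ℕ) : List (List Bool) := unitVecStep^[n] []

/-- The strict majority of a list of votes. -/
def majority (l : List Bool) : Bool := decide (l.count false < l.count true)

/-- All vectors of `L`, shifted by `s`. -/
def shift (L : List (List Bool)) (s : List Bool) : List (List Bool) := L.map fun v => vxor v s

/-- Replace `L` by `L ∪ (L + s)`, where the vector `s` is read from the tape. -/
def spanStep (z : List Bool) (s : List (List Bool) × List Bool) :
    List (List Bool) × List Bool :=
  (s.1 ++ shift s.1 (vxor z s.2), s.2.drop z.length)

/-- The linear span of random vectors from the tape, of at least `u.length` elements, and the rest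
of the tape. -/
def spanList (u z tape : List Bool) : List (List Bool) × List Bool :=
  u.foldl (fun s _ => if decide (s.1.length < u.length) then spanStep z s else s) ([z], tape)

/-- The vote of the samples `L` on the inner product of the secret with `e`. A sample is a vector
preceded by the guess of its inner product with the secret. -/
def vote (G : List Bool → Bool) (L : List (List Bool)) (e : List Bool) : Bool :=
  majority (L.map fun v => xor (v.headD false) (G (vxor v.tail e)))

/-- The guess of the secret that results from the samples `L`. -/
def decode (G : List Bool → Bool) (n : ℕ) (L : List (List Bool)) : List Bool :=
  (unitVecs n).map (vote G L)

/-- The Goldreich-Levin algorithm with oracle `G`: it guesses a vector of the same length as `x`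
with the help of about `u.length` pairwise independent samples. -/
def goldreichLevin (G : List Bool → Bool) (u x tape : List Bool) : List Bool :=
  decode G x.length (shift (spanList u (false :: vzero x) tape).1
    (vxor (false :: vzero x) (spanList u (false :: vzero x) tape).2))

theorem length_vxor (v w : List Bool) : (vxor v w).length = v.length := by
  induction v generalizing w with
  | nil => rfl
  | cons b v ih => simp [vxor, ih]

theorem unitVecs_succ (n : ℕ) : unitVecs (n + 1) = unitVecStep (unitVecs n) :=
  Function.iterate_succ_apply' _ _ _

theorem length_unitVecs (n : ℕ) : (unitVecs n).length = n := by
  induction n with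
  | zero => rfl
  | succ n ih => simp [unitVecs_succ, unitVecStep, ih]

theorem length_of_mem_unitVecs {n : ℕ} {e : List Bool} (he : e ∈ unitVecs n) : e.length = n := by
  induction n generalizing e with
  | zero => simp [unitVecs] at he
  | succ n ih =>
    rw [unitVecs_succ, unitVecStep, List.mem_cons, List.mem_map] at he
    rcases he with rfl | ⟨e, he, rfl⟩
    · simp [length_unitVecs]
    · simp [ih he]

/-! ### Polynomial time of the Goldreich-Levin algorithm -/

section

variable {α : Type} [Enc α]

theorem PT.vxor {v w : α → List Bool} (hv : PT v) (hw : PT w) :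
    PT fun a => vxor (v a) (w a) := by
  -- The accumulator holds the unread part of `w` and the output in reverse order.
  have := PT.foldl_of_esize_le_add
    (f := fun (_ : α) (s : List Bool × List Bool) b =>
      (s.1.tail, Bool.xor b (s.1.headD false) :: s.2))
    (PT.pair (PT.tail (PT.fst (PT.fst (PT.snd PT.id))))
      (PT.cons (PT.xor (PT.snd (PT.snd PT.id)) (PT.headD (PT.fst (PT.fst (PT.snd PT.id)))))
        (PT.snd (PT.fst (PT.snd PT.id)))))
    hv (PT.pair hw (PT.const [])) 4
    (fun a s b => by
      have h₁ := esize_tail_le s.1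
      have h₂ := esize_bool_le (Bool.xor b (s.1.headD false))
      have h₃ := esize_pair s.1 s.2
      simp only [Prod.mk.eta, esize_pair, esize_cons, Polynomial.eval_ofNat] at h₃ ⊢
      omega)
  convert (PT.snd this).reverse using 2 with a
  have key : ∀ v w acc : List Bool, (v.foldl (fun (s : List Bool × List Bool) b =>
      (s.1.tail, Bool.xor b (s.1.headD false) :: s.2)) (w, acc)).2.reverse =
        acc.reverse ++ TCFProtocol.vxor v w := by
    intro v
    induction v with
    | nil => intro w acc; simp [TCFProtocol.vxor]
    | cons b v ih =>
      intro w acc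
      rw [List.foldl_cons, ih]
      simp [TCFProtocol.vxor]
  simpa using (key (v a) (w a) []).symm

theorem PT.vzero {x : α → List Bool} (hx : PT x) : PT fun a => vzero (x a) :=
  PT.map (f := fun _ _ => false) (PT.const _) hx

theorem PT.unitVecs {x : α → List Bool} (hx : PT x) : PT fun a => unitVecs (x a).length := by
  have := PT.foldl (l := x) (s := fun _ => ([] : List (List Bool)))
    (f := fun _ s _ => unitVecStep s)
    (B := fun a => (x a).length * (((x a).length * 4 + 1) + 1) + 1)
    (PT.cons (PT.cons (PT.const _) (PT.map (f := fun _ _ => false) (PT.const _)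
        (PT.fst (PT.snd PT.id))))
      (PT.map (f := fun _ => List.cons false) (PT.cons (PT.const _) (PT.snd PT.id))
        (PT.fst (PT.snd PT.id))))
    hx (PT.const _)
    (((hx.polyBdd_length).mul (((hx.polyBdd_length.mul (PolyBdd.const 4)).add
      (PolyBdd.const 1)).add (PolyBdd.const 1))).add (PolyBdd.const 1))
    (fun a l' hl' => by
      rw [List.foldl_const]
      change esize (TCFProtocol.unitVecs l'.length) ≤ _
      have hle := hl'.length_le
      refine (esize_list_le (B := l'.length * 4 + 1) fun e he => ?_).trans ?_
      · rw [← length_of_mem_unitVecs he]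
        exact esize_str_le e
      · rw [length_unitVecs]
        gcongr)
  simp only [List.foldl_const] at this
  exact this

theorem PT.majority {l : α → List Bool} (hl : PT l) : PT fun a => majority (l a) := by
  -- A unary count of the votes different from `c`; the majority compares the two counts.
  have key : ∀ c : Bool, PT fun a => (l a).foldl
      (fun s b => if Bool.xor b c then true :: s else s) [] := fun c =>
    PT.foldl_of_esize_le_add
      (f := fun (_ : α) (s : List Bool) b => if Bool.xor b c then true :: s else s)
      (PT.ite (PT.xor (PT.snd (PT.snd PT.id)) (PT.const c))
        (PT.cons (PT.const true) (PT.fst (PT.snd PT.id))) (PT.fst (PT.snd PT.id)))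
      hl (PT.const []) 4 (fun a s b => by
        have := esize_bool_le true
        split
        · rw [esize_cons, Polynomial.eval_ofNat]; omega
        · omega)
  have hlen : ∀ (c : Bool) (l s : List Bool), (l.foldl
      (fun s b => if Bool.xor b c then true :: s else s) s).length = l.count (!c) + s.length := by
    intro c l
    induction l with
    | nil => simp
    | cons b l ih =>
      intro s
      rw [List.foldl_cons, ih]
      cases b <;> cases c <;> simp <;> omega
  have := (key true).length_lt (key false)
  simp only [hlen, List.length_nil, add_zero] at this
  exact this

theorem PT.shift {L : α → List (List Bool)} {s : α → List Bool} (hL : PT L) (hs : PT s) :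
    PT fun a => shift (L a) (s a) :=
  PT.map (f := fun a v => TCFProtocol.vxor v (s a))
    (PT.vxor (PT.snd PT.id) (hs.comp (PT.fst PT.id))) hL

/-- Unguarded doubling would give exponentially many vectors. The guard doubles only lists shorter
than `N`, which keeps them below `2 * N`; the extra `1` admits the initial singleton when `N = 0`.
-/
theorem spanStep_bound {z : List Bool} {N K : ℕ} {s : List (List Bool) × List Bool}
    (h₁ : s.1.length ≤ 2 * N + 1) (h₂ : ∀ v ∈ s.1, v.length ≤ z.length) (h₃ : esize s.2 ≤ K) :
    let s' := if decide (s.1.length < N) then spanStep z s else s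
    s'.1.length ≤ 2 * N + 1 ∧ (∀ v ∈ s'.1, v.length ≤ z.length) ∧ esize s'.2 ≤ K := by
  intro s'
  by_cases h : s.1.length < N
  · simp only [s', h, decide_true, if_true, spanStep, TCFProtocol.shift]
    refine ⟨by simp; omega, ?_, ?_⟩
    · intro v hv
      rcases List.mem_append.1 hv with hv | hv
      · exact h₂ v hv
      · obtain ⟨w, hw, rfl⟩ := List.mem_map.1 hv
        rw [length_vxor]
        exact h₂ w hw
    · refine le_trans ?_ h₃
      generalize s.2 = t
      have h := esize_append (t.take z.length) (t.drop z.length)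
      have := esize_pos (t.take z.length)
      rw [List.take_append_drop] at h
      omega
  · simpa [s', h] using ⟨h₁, h₂, h₃⟩

theorem PT.spanList {u z tape : α → List Bool} (hu : PT u) (hz : PT z) (ht : PT tape) :
    PT fun a => spanList (u a) (z a) (tape a) := by
  have hs : PT fun q : α × (List (List Bool) × List Bool) × Bool => q.2.1 := PT.fst (PT.snd PT.id)
  have hz' : PT fun q : α × (List (List Bool) × List Bool) × Bool => z q.1 :=
    hz.comp (PT.fst PT.id)
  refine PT.foldl (l := u) (s := fun a => ([z a], tape a))
    (f := fun a s _ => if decide (s.1.length < (u a).length) then spanStep (z a) s else s)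
    (B := fun a => (2 * (u a).length + 1) * (((z a).length * 4 + 1) + 1) + 1 + esize (tape a) + 1)
    (PT.ite (PT.length_lt (PT.fst hs) (hu.comp (PT.fst PT.id)))
      (PT.pair (PT.append (PT.fst hs) (PT.shift (PT.fst hs) (PT.vxor hz' (PT.snd hs))))
        (PT.drop (PT.snd hs) hz')) hs)
    hu (PT.pair (PT.cons hz (PT.const [])) ht) ?_ fun a l' _ => ?_
  · exact (((((((PolyBdd.const 2).mul hu.polyBdd_length).add (PolyBdd.const 1)).mul
      (((hz.polyBdd_length.mul (PolyBdd.const 4)).add (PolyBdd.const 1)).add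
        (PolyBdd.const 1))).add (PolyBdd.const 1)).add ht.polyBdd).add (PolyBdd.const 1))
  · have key : ∀ (l' : List Bool) (s : List (List Bool) × List Bool),
        s.1.length ≤ 2 * (u a).length + 1 → (∀ v ∈ s.1, v.length ≤ (z a).length) →
        esize s.2 ≤ esize (tape a) → esize (l'.foldl (fun s _ =>
          if decide (s.1.length < (u a).length) then spanStep (z a) s else s) s) ≤
          (2 * (u a).length + 1) * (((z a).length * 4 + 1) + 1) + 1 + esize (tape a) + 1 := by
      intro l'
      induction l' with
      | nil =>
        intro s h₁ h₂ h₃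
        have h := esize_list_le (l := s.1) (B := (z a).length * 4 + 1) fun v hv =>
          (esize_str_le v).trans (by have := h₂ v hv; omega)
        have h' := Nat.mul_le_mul_right ((z a).length * 4 + 1 + 1) h₁
        have h'' := esize_pair s.1 s.2
        rw [List.foldl_nil]
        simp only [Prod.mk.eta] at h''
        omega
      | cons b l' ih =>
        intro s h₁ h₂ h₃
        obtain ⟨h₁, h₂, h₃⟩ := spanStep_bound h₁ h₂ h₃
        exact ih _ h₁ h₂ h₃
    exact key l' _ (by simp) (by simp) le_rfl

theorem PT.vote {G : α → List Bool → Bool} {L : α → List (List Bool)} {e : α → List Bool}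
    (hG : PT fun q : α × List Bool => G q.1 q.2) (hL : PT L) (he : PT e) :
    PT fun a => vote (G a) (L a) (e a) :=
  PT.majority (PT.map
    (f := fun a v => Bool.xor (v.headD false) (G a (TCFProtocol.vxor v.tail (e a))))
    (PT.xor (PT.headD (PT.snd PT.id)) (hG.comp (PT.pair (PT.fst PT.id)
      (PT.vxor (PT.tail (PT.snd PT.id)) (he.comp (PT.fst PT.id)))))) hL)

theorem PT.goldreichLevin {G : α → List Bool → Bool} {u x tape : α → List Bool}
    (hG : PT fun q : α × List Bool => G q.1 q.2) (hu : PT u) (hx : PT x) (ht : PT tape) :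
    PT fun a => goldreichLevin (G a) (u a) (x a) (tape a) := by
  have hz : PT fun a => false :: TCFProtocol.vzero (x a) := PT.cons (PT.const _) hx.vzero
  have hs := PT.spanList hu hz ht
  have hL := PT.shift (PT.fst hs) (PT.vxor hz (PT.snd hs))
  refine PT.map (f := fun a => TCFProtocol.vote (G a) (TCFProtocol.shift _ _)) ?_ hx.unitVecs
  exact PT.vote (G := fun q : α × List Bool => G q.1)
    (hG.comp (PT.pair (PT.fst (PT.fst PT.id)) (PT.snd PT.id)))
    (hL.comp (PT.fst PT.id)) (PT.snd PT.id)

end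

/-! ### The claw finder -/

/-- The parity bit that the two answers of a prover in the last round reveal. The arguments are the
function of the prover, `1^n`, the advice, the coins of the prover, the key and the string `r`. -/
def parityOracle (fn : Data → Data) (v : List Bool × Data × List Bool × List Bool)
    (r : List Bool) : Bool :=
  let b m := (fn (.node (enc v.1) (.node v.2.1 (.node (enc v.2.2.1)
    (.node (enc v.2.2.2) (.node (.node .nil (.node .nil .nil)) (.node (enc m) (enc r)))))))).toBit
  xor (b true) (b false)

/-- The preimage that a prover sends. -/
def preimageOf (fn : Data → Data) (v : List Bool × Data × List Bool × List Bool) : List Bool :=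
  (fn (.node (enc v.1) (.node v.2.1 (.node (enc v.2.2.1)
    (.node (enc v.2.2.2) (.node .nil .nil)))))).toStr

/-- The input of the prover that is run by the claw finder: the coins are an initial segment of
the tape. -/
def proverView (coins : Polynomial ℕ) (v : List Bool × Data × List Bool × List Bool) :
    List Bool × Data × List Bool × List Bool :=
  (v.1, v.2.1, vxor (vzero (List.replicate (coins.eval v.1.length) true)) v.2.2.1, v.2.2.2)

/-- The claw that is derived from a preimage and the Goldreich-Levin algorithm. -/
def findClaw (fn : Data → Data) (coins Q : Polynomial ℕ)
    (v : List Bool × Data × List Bool × List Bool) : List Bool × List Bool :=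
  let w := proverView coins v
  let x := preimageOf fn w
  (x, vxor x (goldreichLevin (parityOracle fn w) (List.replicate (Q.eval v.1.length) true) x
    (v.2.2.1.drop (List.replicate (coins.eval v.1.length) true).length)))

theorem PT.node {α : Type} [Enc α] {f g : α → Data} (hf : PT f) (hg : PT g) :
    PT fun a => Data.node (f a) (g a) := PolyTime.node hf hg

theorem PT.preimageOf {fn : Data → Data} (hfn : PolyTime fn) : PT (preimageOf fn) := by
  have h := PT.id (α := List Bool × Data × List Bool × List Bool)
  have := PT.dec (β := List Bool) ((PT.of_polyTime hfn).comp
    (PT.node h.fst.enc (PT.node h.snd.fst (PT.node h.snd.snd.fst.enc (PT.node h.snd.snd.snd.enc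
      (PT.const (Data.node .nil .nil)))))))
  simp only [dec_str] at this
  exact this

theorem PT.parityOracle {fn : Data → Data} (hfn : PolyTime fn) :
    PT fun q : (List Bool × Data × List Bool × List Bool) × List Bool =>
      parityOracle fn q.1 q.2 := by
  have h := PT.id (α := (List Bool × Data × List Bool × List Bool) × List Bool)
  have key : ∀ m : Bool, _ := fun m => PT.dec (β := Bool) ((PT.of_polyTime hfn).comp
    (PT.node h.fst.fst.enc (PT.node h.fst.snd.fst (PT.node h.fst.snd.snd.fst.enc
      (PT.node h.fst.snd.snd.snd.enc (PT.node (PT.const (.node .nil (.node .nil .nil)))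
        (PT.node (PT.const m).enc h.snd.enc)))))))
  exact (key true).xor (key false)

theorem PT.findClaw {fn : Data → Data} (hfn : PolyTime fn) (coins Q : Polynomial ℕ) :
    PT (findClaw fn coins Q) := by
  have h := PT.id (α := List Bool × Data × List Bool × List Bool)
  have hc := PT.replicate_eval h.fst coins
  have hw : PT (proverView coins) :=
    PT.pair h.fst (PT.pair h.snd.fst (PT.pair (PT.vxor hc.vzero h.snd.snd.fst) h.snd.snd.snd))
  have hx := (PT.preimageOf hfn).comp hw
  refine PT.pair hx (PT.vxor hx (PT.goldreichLevin ?_ (PT.replicate_eval h.fst Q) hx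
    (h.snd.snd.fst.drop hc)))
  exact (PT.parityOracle hfn).comp (PT.pair (hw.comp (PT.fst PT.id)) (PT.snd PT.id))

/-! ### Averages over bit strings -/

/-- The average of `φ` over all bit strings of length `n`. -/
noncomputable def avg : ℕ → (List Bool → ℝ) → ℝ
  | 0, φ => φ []
  | n + 1, φ => (avg n (fun v => φ (true :: v)) + avg n (fun v => φ (false :: v))) / 2

theorem avg_mono {n : ℕ} {φ ψ : List Bool → ℝ} (h : ∀ v, v.length = n → φ v ≤ ψ v) :
    avg n φ ≤ avg n ψ := by
  induction n generalizing φ ψ with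
  | zero => exact h [] rfl
  | succ n ih =>
    have h₁ := ih fun v hv => h (true :: v) (by simp [hv])
    have h₂ := ih fun v hv => h (false :: v) (by simp [hv])
    simp only [avg]
    linarith

theorem avg_congr {n : ℕ} {φ ψ : List Bool → ℝ} (h : ∀ v, v.length = n → φ v = ψ v) :
    avg n φ = avg n ψ :=
  le_antisymm (avg_mono fun v hv => (h v hv).le) (avg_mono fun v hv => (h v hv).ge)

theorem avg_const (n : ℕ) (c : ℝ) : avg n (fun _ => c) = c := by
  induction n with
  | zero => rfl
  | succ n ih => simp [avg, ih]

theorem avg_add (n : ℕ) (φ ψ : List Bool → ℝ) :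
    avg n (fun v => φ v + ψ v) = avg n φ + avg n ψ := by
  induction n generalizing φ ψ with
  | zero => rfl
  | succ n ih => simp only [avg, ih]; ring

theorem avg_mul (n : ℕ) (c : ℝ) (φ : List Bool → ℝ) :
    avg n (fun v => c * φ v) = c * avg n φ := by
  induction n generalizing φ with
  | zero => rfl
  | succ n ih => simp only [avg, ih]; ring

theorem avg_sub (n : ℕ) (φ ψ : List Bool → ℝ) :
    avg n (fun v => φ v - ψ v) = avg n φ - avg n ψ := by
  have := avg_add n φ fun v => -1 * ψ v
  rw [avg_mul] at this
  simp only [neg_mul, one_mul, ← sub_eq_add_neg] at this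
  exact this

theorem avg_nonneg {n : ℕ} {φ : List Bool → ℝ} (h : ∀ v, v.length = n → 0 ≤ φ v) :
    0 ≤ avg n φ :=
  (avg_const n 0).symm.le.trans (avg_mono h)

theorem avg_list_sum {ι : Type*} (n : ℕ) (l : List ι) (φ : ι → List Bool → ℝ) :
    avg n (fun v => (l.map fun i => φ i v).sum) = (l.map fun i => avg n (φ i)).sum := by
  induction l with
  | nil => simp [avg_const]
  | cons i l ih => simp only [List.map_cons, List.sum_cons, avg_add, ih]

theorem avg_append (m n : ℕ) (φ : List Bool → ℝ) :
    avg (m + n) φ = avg m fun v => avg n fun w => φ (v ++ w) := by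
  induction m generalizing φ with
  | zero => simp [avg]
  | succ m ih =>
    rw [Nat.add_right_comm]
    simp only [avg, ih, List.cons_append]

theorem avg_comm (m n : ℕ) (φ : List Bool → List Bool → ℝ) :
    avg m (fun v => avg n (φ v)) = avg n fun w => avg m fun v => φ v w := by
  induction m generalizing φ with
  | zero => rfl
  | succ m ih =>
    simp only [avg, ih]
    rw [← avg_add, div_eq_inv_mul, ← avg_mul]
    exact avg_congr fun _ _ => by ring

theorem avg_vxor (n : ℕ) (φ : List Bool → ℝ) (s : List Bool) :
    avg n (fun v => φ (vxor v s)) = avg n φ := by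
  induction n generalizing φ s with
  | zero => rfl
  | succ n ih =>
    simp only [avg, vxor]
    rw [ih (fun v => φ (xor true (s.headD false) :: v)),
      ih (fun v => φ (xor false (s.headD false) :: v))]
    cases s.headD false
    · rfl
    · simp [add_comm]

/-! ### Vectors over the field with two elements -/

theorem vxor_comm {n : ℕ} {v w : List Bool} (hv : v.length = n) (hw : w.length = n) :
    vxor v w = vxor w v := by
  induction n generalizing v w with
  | zero => rw [List.length_eq_zero_iff.1 hv, List.length_eq_zero_iff.1 hw]
  | succ n ih =>
    obtain ⟨a, v, rfl⟩ := List.exists_of_length_succ v hv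
    obtain ⟨b, w, rfl⟩ := List.exists_of_length_succ w hw
    simp only [List.length_cons, Nat.add_right_cancel_iff] at hv hw
    simp [vxor, ih hv hw, Bool.xor_comm]

theorem vxor_assoc {n : ℕ} {u v : List Bool} (hu : u.length = n) (hv : v.length = n)
    (w : List Bool) : vxor (vxor u v) w = vxor u (vxor v w) := by
  induction n generalizing u v w with
  | zero => rw [List.length_eq_zero_iff.1 hu]; rfl
  | succ n ih =>
    obtain ⟨a, u, rfl⟩ := List.exists_of_length_succ u hu
    obtain ⟨b, v, rfl⟩ := List.exists_of_length_succ v hv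
    simp only [List.length_cons, Nat.add_right_cancel_iff] at hu hv
    simp [vxor, ih hu hv]

theorem vxor_vxor_cancel {n : ℕ} {v w : List Bool} (hv : v.length = n) (hw : w.length = n) :
    vxor v (vxor v w) = w := by
  induction n generalizing v w with
  | zero => rw [List.length_eq_zero_iff.1 hv, List.length_eq_zero_iff.1 hw]; rfl
  | succ n ih =>
    obtain ⟨a, v, rfl⟩ := List.exists_of_length_succ v hv
    obtain ⟨b, w, rfl⟩ := List.exists_of_length_succ w hw
    simp only [List.length_cons, Nat.add_right_cancel_iff] at hv hw
    simp [vxor, ih hv hw]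

theorem length_vzero (x : List Bool) : (vzero x).length = x.length := by simp [vzero]

/-- This is how blocks are read from a random tape: `vxor` cuts its second argument to the length of
the first, so adding it to zero returns an initial segment. -/
theorem vxor_vzero_append {x v : List Bool} (h : v.length = x.length) (w : List Bool) :
    vxor (vzero x) (v ++ w) = v := by
  induction x generalizing v with
  | nil => rw [List.length_eq_zero_iff.1 h]; rfl
  | cons b x ih =>
    obtain ⟨a, v, rfl⟩ := List.exists_of_length_succ v h
    simp only [List.length_cons, Nat.add_right_cancel_iff] at h
    simp only [vzero, List.map_cons, List.cons_append, vxor] at ih ⊢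
    simpa using ih h

theorem dot_cons (a b : Bool) (v w : List Bool) :
    dot (a :: v) (b :: w) = xor (a && b) (dot v w) := rfl

theorem dot_vxor_left {n : ℕ} {v w x : List Bool} (hv : v.length = n) (hw : w.length = n)
    (hx : x.length = n) : dot (vxor v w) x = xor (dot v x) (dot w x) := by
  induction n generalizing v w x with
  | zero =>
    rw [List.length_eq_zero_iff.1 hv, List.length_eq_zero_iff.1 hw]
    rfl
  | succ n ih =>
    obtain ⟨a, v, rfl⟩ := List.exists_of_length_succ v hv
    obtain ⟨b, w, rfl⟩ := List.exists_of_length_succ w hw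
    obtain ⟨c, x, rfl⟩ := List.exists_of_length_succ x hx
    simp only [List.length_cons, Nat.add_right_cancel_iff] at hv hw hx
    simp only [vxor, dot_cons, List.headD_cons, List.tail_cons, ih hv hw hx]
    cases a <;> cases b <;> cases c <;> cases dot v x <;> cases dot w x <;> rfl

theorem dot_comm (v w : List Bool) : dot v w = dot w v := by
  induction v generalizing w with
  | nil => cases w <;> rfl
  | cons a v ih =>
    cases w with
    | nil => rfl
    | cons b w => rw [dot_cons, dot_cons, ih, Bool.and_comm]

theorem dot_vxor_right {n : ℕ} {v w x : List Bool} (hv : v.length = n) (hw : w.length = n)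
    (hx : x.length = n) : dot x (vxor v w) = xor (dot x v) (dot x w) := by
  rw [dot_comm, dot_vxor_left hv hw hx, dot_comm v, dot_comm w]

theorem dot_vzero (x y : List Bool) : dot (vzero x) y = false := by
  induction x generalizing y with
  | nil => rfl
  | cons a x ih =>
    cases y with
    | nil => rfl
    | cons b y =>
      simp only [vzero, List.map_cons, dot_cons] at ih ⊢
      simpa using ih y

theorem map_dot_unitVecs {n : ℕ} {x : List Bool} (hx : x.length = n) :
    (unitVecs n).map (fun e => dot e x) = x := by
  induction n generalizing x with
  | zero => rw [List.length_eq_zero_iff.1 hx]; rfl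
  | succ n ih =>
    obtain ⟨b, x, rfl⟩ := List.exists_of_length_succ x hx
    simp only [List.length_cons, Nat.add_right_cancel_iff] at hx
    have h₀ : dot ((unitVecs n).map fun _ => false) x = false := by
      have := dot_vzero (List.replicate n false) x
      simpa [vzero, length_unitVecs, List.map_const'] using this
    simp only [unitVecs_succ, unitVecStep, List.map_cons, List.map_map, dot_cons, h₀]
    simp only [Function.comp_def, dot_cons, Bool.false_and, Bool.false_xor]
    rw [ih hx]
    simp

/-! ### Analysis of the Goldreich-Levin algorithm -/

/-- The indicator of a proposition. -/
noncomputable def ind (p : Prop) : ℝ :=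
  open Classical in if p then 1 else 0

theorem ind_of_true {p : Prop} (h : p) : ind p = 1 := if_pos h

theorem ind_of_false {p : Prop} (h : ¬p) : ind p = 0 := if_neg h

theorem ind_nonneg (p : Prop) : 0 ≤ ind p := by
  by_cases h : p <;> simp [ind, h]

theorem ind_le_one (p : Prop) : ind p ≤ 1 := by
  by_cases h : p <;> simp [ind, h]

theorem sign_xor (a b : Bool) : sign (xor a b) = sign a * sign b := by
  cases a <;> cases b <;> simp [sign]

theorem sum_sign_eq (l : List Bool) :
    (l.map sign).sum = (l.count false : ℝ) - l.count true := by
  induction l with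
  | nil => simp
  | cons b l ih => cases b <;> simp [ih, sign] <;> ring

theorem majority_eq {l : List Bool} {b : Bool} (h : 0 < sign b * (l.map sign).sum) :
    majority l = b := by
  rw [sum_sign_eq] at h
  cases b
  · have : (l.count true : ℝ) < l.count false := by simpa [sign] using h
    have : l.count true < l.count false := by exact_mod_cast this
    simp [majority, this.le]
  · have : (l.count false : ℝ) < l.count true := by simpa [sign] using h
    have : l.count false < l.count true := by exact_mod_cast this
    simp [majority, this]

/-- Correct samples: each vector is preceded by its inner product with the secret. -/
def correctSamples (x : List Bool) (R : List (List Bool)) : List (List Bool) :=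
  R.map fun r => dot r x :: r

/-- The inner product is additive, so a single correct guess, for the shift `s`, keeps the guesses
for all samples correct. -/
theorem shift_correctSamples {x s : List Bool} (hs : s.length = x.length) {R : List (List Bool)}
    (hR : ∀ r ∈ R, r.length = x.length) :
    shift (correctSamples x R) (dot s x :: s) = correctSamples x (shift R s) := by
  simp only [shift, correctSamples, List.map_map]
  refine List.map_congr_left fun r hr => ?_
  simp [vxor, dot_vxor_left (hR r hr) hs rfl]

/-- The agreement, as a sign, of the oracle with the inner product with the secret. -/
noncomputable def agreement (G : List Bool → Bool) (x r : List Bool) : ℝ :=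
  sign (xor (G r) (dot r x))

/-- The deviation of the votes on `e` of the samples `R + s` from its expectation. -/
noncomputable def deviation (G : List Bool → Bool) (x e : List Bool) (R : List (List Bool))
    (s : List Bool) : ℝ :=
  (R.map fun r => agreement G x (vxor (vxor r s) e) - avg x.length (agreement G x)).sum

theorem agreement_sq (G : List Bool → Bool) (x r : List Bool) : agreement G x r ^ 2 = 1 := by
  unfold agreement sign
  split <;> norm_num

theorem deviation_append (G : List Bool → Bool) (x e : List Bool) (R R' : List (List Bool))
    (s : List Bool) :
    deviation G x e (R ++ R') s = deviation G x e R s + deviation G x e R' s := by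
  simp [deviation]

theorem deviation_shift (G : List Bool → Bool) {x e s t : List Bool} {R : List (List Bool)}
    (hR : ∀ r ∈ R, r.length = x.length) (hs : s.length = x.length) (ht : t.length = x.length) :
    deviation G x e (shift R s) t = deviation G x e R (vxor t s) := by
  simp only [deviation, shift, List.map_map, Function.comp_def]
  congr 1
  refine List.map_congr_left fun r hr => ?_
  rw [vxor_assoc (hR r hr) hs, vxor_comm hs ht]

/-- For uniform `s` each argument `r + s + e` is uniform, so every summand has mean zero. -/
theorem avg_deviation (G : List Bool → Bool) {x e : List Bool} {R : List (List Bool)}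
    (hR : ∀ r ∈ R, r.length = x.length) : avg x.length (deviation G x e R) = 0 := by
  unfold deviation
  rw [avg_list_sum]
  refine List.sum_eq_zero fun y hy => ?_
  obtain ⟨r, hr, rfl⟩ := List.mem_map.1 hy
  rw [avg_sub, avg_const, sub_eq_zero,
    avg_congr (ψ := fun s => agreement G x (vxor (vxor s r) e))
      fun s hs => by rw [vxor_comm (hR r hr) hs],
    avg_vxor x.length (fun s => agreement G x (vxor s e)), avg_vxor]

/-- The sum over the unit vectors `e` of the mean squares of the deviations. -/
noncomputable def totalVariance (G : List Bool → Bool) (x : List Bool) (R : List (List Bool)) : ℝ :=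
  ((unitVecs x.length).map fun e => avg x.length fun s => deviation G x e R s ^ 2).sum

/-- This replaces pairwise independence. With `A` the deviation of `R`, that of the doubled list at
`t` is `A t + A (t + s)`. Both squares have the same mean, and the cross term vanishes because `A (t
+ s)` has mean zero over `s` for fixed `t`. -/
theorem avg_sq_deviation_append_shift (G : List Bool → Bool) {x e : List Bool}
    {R : List (List Bool)} (hR : ∀ r ∈ R, r.length = x.length) :
    avg x.length (fun s => avg x.length fun t => deviation G x e (R ++ shift R s) t ^ 2) =
      2 * avg x.length (fun t => deviation G x e R t ^ 2) := by
  set A := deviation G x e R with hA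
  have h₁ : ∀ s, s.length = x.length →
      avg x.length (fun t => deviation G x e (R ++ shift R s) t ^ 2) =
        2 * avg x.length (fun t => A t ^ 2) + 2 * avg x.length fun t => A t * A (vxor t s) := by
    intro s hs
    rw [avg_congr (ψ := fun t => A t ^ 2 + (A (vxor t s) ^ 2 + 2 * (A t * A (vxor t s))))
      fun t ht => by rw [deviation_append, deviation_shift G hR hs ht, ← hA]; ring]
    rw [avg_add, avg_add, avg_mul, avg_vxor x.length (fun t => A t ^ 2)]
    ring
  rw [avg_congr h₁, avg_add, avg_const, avg_mul, avg_comm]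
  have h₂ : avg x.length (fun t => avg x.length fun s => A t * A (vxor t s)) = 0 := by
    rw [← avg_const x.length 0]
    refine avg_congr fun t ht => ?_
    rw [avg_mul, avg_congr (ψ := fun s => A (vxor s t)) fun s hs => by rw [vxor_comm ht hs],
      avg_vxor, avg_deviation G hR, mul_zero]
  rw [h₂]
  ring

theorem avg_totalVariance_append_shift (G : List Bool → Bool) {x : List Bool}
    {R : List (List Bool)} (hR : ∀ r ∈ R, r.length = x.length) :
    avg x.length (fun s => totalVariance G x (R ++ shift R s)) = 2 * totalVariance G x R := by
  unfold totalVariance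
  rw [avg_list_sum, ← List.sum_map_mul_left]
  simp only [avg_sq_deviation_append_shift G hR]

/-- A single sample has a vote `±1` with mean `μ`, hence variance `1 - μ ^ 2 ≤ 1`, for each of the
unit vectors. -/
theorem totalVariance_vzero_le (G : List Bool → Bool) (x : List Bool) :
    totalVariance G x [vzero x] ≤ x.length := by
  have h : ∀ e, avg x.length (fun s => deviation G x e [vzero x] s ^ 2) ≤ 1 := by
    intro e
    set μ := avg x.length (agreement G x) with hμ
    rw [avg_congr (ψ := fun s => (1 + μ ^ 2) - 2 * μ * agreement G x (vxor s e)) fun s hs => by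
      have h := agreement_sq G x (vxor s e)
      have hz : vxor (vzero x) s = s := by simpa using vxor_vzero_append hs []
      simp only [deviation, List.map_cons, List.map_nil, List.sum_cons, List.sum_nil, hz, ← hμ]
      linear_combination h]
    rw [avg_sub, avg_const, avg_mul, avg_vxor, ← hμ]
    nlinarith [sq_nonneg μ]
  calc totalVariance G x [vzero x] ≤ ((unitVecs x.length).map fun _ => (1 : ℝ)).sum :=
        List.sum_le_sum fun e _ => h e
    _ = x.length := by simp [length_unitVecs]

/-- The vote `G (r + e) + r·x` equals `e·x` plus the error of the oracle at `r + e`, so a positive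
total agreement makes the majority correct. -/
theorem vote_correctSamples (G : List Bool → Bool) {x e : List Bool} {R : List (List Bool)}
    (hR : ∀ r ∈ R, r.length = x.length) (he : e.length = x.length)
    (h : 0 < (R.map fun r => agreement G x (vxor r e)).sum) :
    vote G (correctSamples x R) e = dot e x := by
  refine majority_eq (h.trans_eq ?_)
  rw [← List.sum_map_mul_left, List.map_map, correctSamples, List.map_map]
  congr 1
  refine List.map_congr_left fun r hr => ?_
  simp only [Function.comp_apply, List.headD_cons, List.tail_cons, agreement,
    dot_vxor_left (hR r hr) he rfl]
  simp only [← sign_xor]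
  congr 1
  cases G (vxor r e) <;> cases dot r x <;> cases dot e x <;> rfl

/-- Chebyshev's inequality and the union bound in pointwise form: a wrong coordinate forces a
deviation of absolute value at least `R.length * μ`, so the sum of squares divided by its square is
at least `1`. -/
theorem decode_correctSamples_ge (G : List Bool → Bool) {x s : List Bool} {R : List (List Bool)}
    (hR : ∀ r ∈ R, r.length = x.length) (hne : R ≠ []) (hμ : 0 < avg x.length (agreement G x)) :
    1 - ((unitVecs x.length).map fun e => deviation G x e R s ^ 2).sum /
        (R.length * avg x.length (agreement G x)) ^ 2 ≤
      ind (decode G x.length (correctSamples x (shift R s)) = x) := by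
  set μ := avg x.length (agreement G x) with hμ'
  have hpos : 0 < (R.length * μ) ^ 2 := by
    have : 0 < R.length := List.length_pos_iff.2 hne
    positivity
  by_cases h : ∀ e ∈ unitVecs x.length, 0 < R.length * μ + deviation G x e R s
  · rw [ind_of_true]
    · have : 0 ≤ ((unitVecs x.length).map fun e => deviation G x e R s ^ 2).sum :=
        List.sum_nonneg fun y hy => by
          obtain ⟨e, _, rfl⟩ := List.mem_map.1 hy
          positivity
      linarith [div_nonneg this hpos.le]
    · refine Eq.trans (List.map_congr_left fun e he => ?_) (map_dot_unitVecs rfl)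
      refine vote_correctSamples G (fun r hr => ?_) (length_of_mem_unitVecs he) ?_
      · obtain ⟨r, hr', rfl⟩ := List.mem_map.1 hr
        rw [length_vxor, hR r hr']
      · refine (h e he).trans_eq ?_
        simp only [deviation, shift, List.map_map, Function.comp_def, ← hμ']
        have : ∀ (R : List (List Bool)) (φ : List Bool → ℝ),
            R.length * μ + (R.map fun r => φ r - μ).sum = (R.map φ).sum := by
          intro R φ
          induction R with
          | nil => simp
          | cons r R ih =>
            simp only [List.map_cons, List.sum_cons, List.length_cons, ← ih]
            push_cast
            ring
        exact this R _
  · push Not at h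
    obtain ⟨e, he, h⟩ := h
    have h₁ : (R.length * μ) ^ 2 ≤ deviation G x e R s ^ 2 := by
      have : 0 ≤ R.length * μ := by positivity
      nlinarith
    have h₂ : deviation G x e R s ^ 2 ≤
        ((unitVecs x.length).map fun e => deviation G x e R s ^ 2).sum :=
      List.single_le_sum (fun y hy => by
        obtain ⟨e, _, rfl⟩ := List.mem_map.1 hy
        positivity) _ (List.mem_map.2 ⟨e, he, rfl⟩)
    have := (one_le_div hpos).2 (h₁.trans h₂)
    linarith [ind_nonneg (decode G x.length (correctSamples x (shift R s)) = x)]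

/-- The leading random bit is the guess of `s·x`. It is right half of the time, and the other half
contributes at least zero. -/
theorem half_avg_le_avg_succ (x : List Bool) {n : ℕ} {φ : List Bool → ℝ} (h : ∀ v, 0 ≤ φ v) :
    1 / 2 * avg n (fun s => φ (dot s x :: s)) ≤ avg (n + 1) φ := by
  have : avg n (fun s => φ (dot s x :: s)) ≤ avg n fun s => φ (true :: s) + φ (false :: s) :=
    avg_mono fun s _ => by
      have := h (true :: s)
      have := h (false :: s)
      cases dot s x <;> simpa
  rw [avg_add] at this
  simp only [avg]
  linarith

theorem vxor_cons_vzero_append {x v : List Bool} (h : v.length = x.length + 1) (w : List Bool) :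
    vxor (false :: vzero x) (v ++ w) = v :=
  vxor_vzero_append (x := false :: x) h w

/-- Each doubling multiplies both the mean variance and the number of samples by `2`, and so halves
the Chebyshev bound. Each of the `t + 1` blocks read, including the final shift, costs a factor
`1/2` for its guess. `K` counts the unread bits of the tape. -/
theorem avg_decode_spanStep_ge (G : List Bool → Bool) {x : List Bool}
    (hμ : 0 < avg x.length (agreement G x)) (K t : ℕ) {R : List (List Bool)}
    (hR : ∀ r ∈ R, r.length = x.length) (hne : R ≠ []) :
    (1 - totalVariance G x R / (2 ^ t * (R.length * avg x.length (agreement G x)) ^ 2)) /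
        2 ^ (t + 1) ≤
      avg ((t + 1) * (x.length + 1) + K) fun tape =>
        let s := (spanStep (false :: vzero x))^[t] (correctSamples x R, tape)
        ind (decode G x.length (shift s.1 (vxor (false :: vzero x) s.2)) = x) := by
  set μ := avg x.length (agreement G x) with hμ'
  induction t generalizing R with
  | zero =>
    simp only [Function.iterate_zero, id_eq, zero_add, one_mul, pow_zero, pow_one]
    rw [avg_append]
    have h₁ : avg (x.length + 1) (fun v => avg K fun w => ind (decode G x.length
        (shift (correctSamples x R) (vxor (false :: vzero x) (v ++ w))) = x)) =
        avg (x.length + 1) fun v =>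
          ind (decode G x.length (shift (correctSamples x R) v) = x) :=
      avg_congr fun v hv => by simp only [vxor_cons_vzero_append hv, avg_const]
    rw [h₁]
    refine le_trans ?_ (half_avg_le_avg_succ x fun v => ind_nonneg _)
    have h₂ : avg x.length (fun s => 1 - ((R.length * μ) ^ 2)⁻¹ *
        ((unitVecs x.length).map fun e => deviation G x e R s ^ 2).sum) ≤
        avg x.length fun s =>
          ind (decode G x.length (shift (correctSamples x R) (dot s x :: s)) = x) :=
      avg_mono fun s hs => by
        rw [shift_correctSamples hs hR, inv_mul_eq_div]
        exact decode_correctSamples_ge G hR hne hμ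
    rw [avg_sub, avg_const, avg_mul, avg_list_sum, inv_mul_eq_div] at h₂
    unfold totalVariance
    linarith
  | succ t ih =>
    have e₁ : (t + 1 + 1) * (x.length + 1) + K =
      (x.length + 1) + ((t + 1) * (x.length + 1) + K) := by ring
    rw [e₁, avg_append]
    simp only [Function.iterate_succ_apply]
    have h₁ : ∀ v, v.length = x.length + 1 → ∀ w,
        spanStep (false :: vzero x) (correctSamples x R, v ++ w) =
          (correctSamples x R ++ shift (correctSamples x R) v, w) := by
      intro v hv w
      simp only [spanStep, vxor_cons_vzero_append hv, List.length_cons, length_vzero]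
      rw [← hv, List.drop_left]
    let φ : List Bool → ℝ := fun v => avg ((t + 1) * (x.length + 1) + K) fun tape =>
        let s := (spanStep (false :: vzero x))^[t]
          (correctSamples x R ++ shift (correctSamples x R) v, tape)
        ind (decode G x.length (shift s.1 (vxor (false :: vzero x) s.2)) = x)
    rw [avg_congr (ψ := φ) fun v hv => by simp only [h₁ v hv, φ]]
    refine le_trans ?_ (half_avg_le_avg_succ x fun v => avg_nonneg fun _ _ => ind_nonneg _)
    -- The induction hypothesis is affine in the variance of the doubled list, so it can be averaged
    -- over `s`, whatever its sign.
    have h₂ : ∀ s, s.length = x.length → (1 / 2 ^ (t + 1) -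
        (2 ^ (t + 1) * (2 ^ t * (2 * R.length * μ) ^ 2))⁻¹ * totalVariance G x (R ++ shift R s)) ≤
        φ (dot s x :: s) := by
      intro s hs
      have hR' : ∀ r ∈ R ++ shift R s, r.length = x.length := by
        intro r hr
        rcases List.mem_append.1 hr with hr | hr
        · exact hR r hr
        · obtain ⟨r, hr', rfl⟩ := List.mem_map.1 hr
          rw [length_vxor, hR r hr']
      have h := ih hR' (by simp [hne])
      have hc : correctSamples x R ++ shift (correctSamples x R) (dot s x :: s) =
          correctSamples x (R ++ shift R s) := by
        rw [shift_correctSamples hs hR]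
        simp [correctSamples]
      simp only [φ, hc]
      refine le_trans (le_of_eq ?_) h
      have hl : ((R ++ shift R s).length : ℝ) = 2 * R.length := by
        simp [shift]; ring
      rw [hl]
      have : (R.length : ℝ) ≠ 0 := by simpa using hne
      field_simp
    have h₃ := avg_mono h₂
    rw [avg_sub, avg_const, avg_mul, avg_totalVariance_append_shift G hR] at h₃
    refine le_trans (le_of_eq ?_) (mul_le_mul_of_nonneg_left h₃ (by norm_num))
    have : (R.length : ℝ) ≠ 0 := by simpa using hne
    field_simp
    ring

theorem length_spanStep_iterate (z : List Bool) (s : List (List Bool) × List Bool) (t : ℕ) :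
    ((spanStep z)^[t] s).1.length = 2 ^ t * s.1.length := by
  induction t with
  | zero => simp
  | succ t ih =>
    rw [Function.iterate_succ_apply', spanStep, List.length_append, shift, List.length_map, ih]
    ring

/-- After `k` doublings there are `2 ^ k` vectors, so the guard stops exactly at `Nat.clog 2
u.length`, and a fold over `u` has enough rounds to get there. -/
theorem spanList_eq (u z tape : List Bool) :
    spanList u z tape = (spanStep z)^[Nat.clog 2 u.length] ([z], tape) := by
  have key : ∀ k, (fun s : List (List Bool) × List Bool =>
      if decide (s.1.length < u.length) then spanStep z s else s)^[k] ([z], tape) =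
        (spanStep z)^[min k (Nat.clog 2 u.length)] ([z], tape) := by
    intro k
    induction k with
    | zero => simp
    | succ k ih =>
      rw [Function.iterate_succ_apply', ih]
      have h := length_spanStep_iterate z ([z], tape) (min k (Nat.clog 2 u.length))
      rw [List.length_singleton, mul_one] at h
      simp only [h, ← Nat.lt_clog_iff_pow_lt one_lt_two, decide_eq_true_eq]
      by_cases hk : k < Nat.clog 2 u.length
      · rw [min_eq_left hk.le, if_pos hk, min_eq_left hk, Function.iterate_succ_apply']
      · rw [min_eq_right (by omega), if_neg (lt_irrefl _), min_eq_right (by omega)]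
  rw [spanList, List.foldl_const, key, min_eq_right]
  exact Nat.clog_le_of_le_pow Nat.lt_two_pow_self.le

/-- The Goldreich-Levin algorithm finds the secret `x` with non-negligible probability if the
oracle `G` has non-negligible correlation with the inner product with `x`. -/
theorem avg_goldreichLevin_ge (G : List Bool → Bool) {u x x' : List Bool} {μ : ℝ} {M : ℕ}
    (hx : x'.length = x.length) (hμ : 0 < μ) (hG : μ ≤ avg x.length (agreement G x))
    (hu : u ≠ []) (hN : 2 * x.length ≤ u.length * μ ^ 2)
    (hM : (u.length + 1) * (x.length + 1) ≤ M) :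
    1 / (8 * u.length) ≤ avg M fun tape => ind (goldreichLevin G u x' tape = x) := by
  set t := Nat.clog 2 u.length with ht
  have hpos : 0 < u.length := List.length_pos_iff.2 hu
  have htu : t ≤ u.length := Nat.clog_le_of_le_pow Nat.lt_two_pow_self.le
  have h₁ : u.length ≤ 2 ^ t := Nat.le_pow_clog one_lt_two _
  have h₂ : 2 ^ t ≤ 2 * u.length := by
    rcases Nat.eq_zero_or_pos t with h | h
    · rw [h]; omega
    · obtain ⟨t', ht'⟩ := Nat.exists_eq_succ_of_ne_zero h.ne'
      have : 2 ^ t' < u.length := by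
        rw [← Nat.lt_clog_iff_pow_lt one_lt_two]
        omega
      rw [ht', pow_succ]
      omega
  obtain ⟨K, hK⟩ := Nat.exists_eq_add_of_le
    ((Nat.mul_le_mul_right (x.length + 1) (Nat.add_le_add_right htu 1)).trans hM)
  -- Apart from the oracle and the tape, only the length of the secret matters, so a known string
  -- `x'` can stand in for it.
  have hz : vzero x' = vzero x := by
    simp [vzero, List.map_const', hx]
  have h := avg_decode_spanStep_ge G (hμ.trans_le hG) K t (R := [vzero x])
    (by simp [length_vzero]) (by simp)
  have hc : correctSamples x [vzero x] = [false :: vzero x] := by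
    simp [correctSamples, dot_vzero]
  rw [← hK, hc] at h
  have hgl : (fun tape => ind (goldreichLevin G u x' tape = x)) = fun tape =>
      let s := (spanStep (false :: vzero x))^[t] ([false :: vzero x], tape)
      ind (decode G x.length (shift s.1 (vxor (false :: vzero x) s.2)) = x) := by
    funext tape
    simp only [goldreichLevin, hz, hx, spanList_eq, ht]
  rw [hgl]
  refine le_trans ?_ h
  set μ' := avg x.length (agreement G x)
  have hv := totalVariance_vzero_le G x
  have hu' : (0 : ℝ) < u.length := by exact_mod_cast hpos
  have h₁' : (u.length : ℝ) ≤ 2 ^ t := by exact_mod_cast h₁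
  have h₂' : (2 : ℝ) ^ t ≤ 2 * u.length := by exact_mod_cast h₂
  have h₃ : μ ^ 2 ≤ μ' ^ 2 := by gcongr
  have h₄ : u.length * μ ^ 2 ≤ 2 ^ t * μ' ^ 2 := by gcongr
  have hden : 0 < 2 ^ t * μ' ^ 2 := lt_of_lt_of_le (by positivity) h₄
  -- By `hN` decoding with correct guesses fails with probability at most `1/2`. The guesses are all
  -- correct with probability `1 / 2 ^ (t + 1)`, which is at least `1 / (4 * u.length)`.
  have h₅ : totalVariance G x [vzero x] / (2 ^ t * μ' ^ 2) ≤ 1 / 2 := by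
    rw [div_le_iff₀ hden]
    linarith
  rw [List.length_singleton, Nat.cast_one, one_mul]
  calc 1 / (8 * (u.length : ℝ)) = (1 / 2) / (4 * u.length) := by ring
    _ ≤ (1 / 2) / 2 ^ (t + 1) := by
      rw [pow_succ]
      exact div_le_div_of_nonneg_left (by norm_num) (by positivity) (by linarith)
    _ ≤ _ := by
      gcongr
      linarith

/-! ### Probabilities as averages -/

theorem avg_eq_sum (n : ℕ) (φ : List Bool → ℝ) :
    avg n φ = (∑ v : Fin n → Bool, φ (List.ofFn v)) / 2 ^ n := by
  induction n generalizing φ with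
  | zero => simp [avg]
  | succ n ih =>
    rw [avg, ih, ih, ← (Fin.consEquiv fun _ => Bool).sum_comp, Fintype.sum_prod_type,
      Fintype.sum_bool]
    simp only [Fin.consEquiv, Equiv.coe_fn_mk, List.ofFn_cons]
    rw [pow_succ]
    ring

theorem Pr_nonneg (g : PMF Prop) : 0 ≤ Pr g := ENNReal.toReal_nonneg

theorem Pr_le_one (g : PMF Prop) : Pr g ≤ 1 :=
  ENNReal.toReal_le_of_le_ofReal zero_le_one (by simpa using g.coe_le_one True)

theorem Pr_pure (p : Prop) : Pr (pure p) = ind p := by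
  change ((PMF.pure p) True).toReal = ind p
  by_cases h : p <;> simp [PMF.pure_apply, ind, h]

theorem Pr_bind {α : Type} (p : PMF α) (g : α → PMF Prop) :
    Pr (p >>= g) = ∑' a, (p a).toReal * Pr (g a) := by
  change ((p.bind g) True).toReal = _
  rw [PMF.bind_apply, ENNReal.tsum_toReal_eq]
  · simp only [ENNReal.toReal_mul]
    rfl
  · exact fun a => ENNReal.mul_ne_top (p.apply_ne_top a) ((g a).apply_ne_top True)

theorem Pr_randomStr_bind (n : ℕ) (g : List Bool → PMF Prop) :
    Pr (randomStr n >>= g) = avg n fun v => Pr (g v) := by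
  have : randomStr n >>= g =
      PMF.uniformOfFintype (Fin n → Bool) >>= fun v => g (List.ofFn v) := by
    change (PMF.map _ _).bind g = _
    rw [PMF.bind_map]
    rfl
  rw [this, Pr_bind, tsum_fintype, avg_eq_sum, Finset.sum_div]
  refine Finset.sum_congr rfl fun v _ => ?_
  simp [PMF.uniformOfFintype_apply]
  ring

theorem Pr_randomBit_bind (g : Bool → PMF Prop) :
    Pr (randomBit >>= g) = (Pr (g true) + Pr (g false)) / 2 := by
  rw [Pr_bind, tsum_fintype, Fintype.sum_bool]
  simp [randomBit, PMF.uniformOfFintype_apply]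
  ring

/-- The type of keys is infinite; `HasSum` allows the games to be combined linearly and compared key
by key. -/
theorem hasSum_Pr_bind {α : Type} (p : PMF α) (g : α → PMF Prop) :
    HasSum (fun a => (p a).toReal * Pr (g a)) (Pr (p >>= g)) := by
  rw [Pr_bind]
  refine (Summable.of_nonneg_of_le (fun a => ?_) (fun a => ?_)
    (ENNReal.summable_toReal p.tsum_coe_ne_top)).hasSum
  · exact mul_nonneg ENNReal.toReal_nonneg (Pr_nonneg _)
  · exact mul_le_of_le_one_right ENNReal.toReal_nonneg (Pr_le_one _)

theorem hasSum_toReal {α : Type} (p : PMF α) : HasSum (fun a => (p a).toReal) 1 := by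
  have := (ENNReal.summable_toReal p.tsum_coe_ne_top).hasSum
  rwa [← ENNReal.tsum_toReal_eq fun a => p.apply_ne_top a, p.tsum_coe, ENNReal.toReal_one] at this

/-! ### The two answers in the last round -/

theorem bornWeight_eq (θ : ℝ) (ψ : Bool → ℝ) (b : Bool) :
    bornWeight θ ψ b =
      if b then (-Real.sin (θ / 2) * ψ false + Real.cos (θ / 2) * ψ true) ^ 2
      else (Real.cos (θ / 2) * ψ false + Real.sin (θ / 2) * ψ true) ^ 2 := by
  cases b <;> simp [bornWeight, rotatedKet, ket] <;> ring

/-- The more likely outcome of the measurement: for a qubit in the standard basis it does not depend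
on the angle, for a qubit in the Hadamard basis it does. -/
theorem eq_of_bornWeight_lt {r d x₀ x₁ : List Bool} {m b : Bool}
    (h : bornWeight (angle m) (qubit r d x₀ x₁) (!b) < bornWeight (angle m) (qubit r d x₀ x₁) b) :
    b = if dot r x₀ = dot r x₁ then dot r x₀ else xor (xor (dot d x₀) (dot d x₁)) (!m) := by
  have hπ := Real.pi_pos
  have hs : 0 < Real.sin (Real.pi / 4 / 2) :=
    Real.sin_pos_of_pos_of_lt_pi (by positivity) (by linarith)
  have hc : 0 < Real.cos (Real.pi / 4 / 2) :=
    Real.cos_pos_of_mem_Ioo ⟨by linarith, by linarith⟩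
  -- This positive quantity decides the outcome for `|0⟩` and `|1⟩`; for `|+⟩` and `|-⟩` it is the
  -- product of sine and cosine.
  have hcs : 0 < Real.cos (Real.pi / 4 / 2) ^ 2 - Real.sin (Real.pi / 4 / 2) ^ 2 := by
    rw [← Real.cos_two_mul']
    exact Real.cos_pos_of_mem_Ioo ⟨by linarith, by linarith⟩
  have hsc := mul_pos hs hc
  rw [bornWeight_eq, bornWeight_eq] at h
  have hneg : -(Real.pi / 4) / 2 = -(Real.pi / 4 / 2) := by ring
  cases m <;> simp only [angle, hneg, Real.sin_neg, Real.cos_neg, if_true, if_false,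
    Bool.false_eq_true] at h <;>
  generalize Real.sin (Real.pi / 4 / 2) = s at * <;>
  generalize Real.cos (Real.pi / 4 / 2) = c at * <;>
  unfold qubit at h <;>
  generalize dot r x₀ = r₀ at * <;> generalize dot r x₁ = r₁ at * <;>
  generalize dot d x₀ = d₀ at * <;> generalize dot d x₁ = d₁ at * <;>
  cases r₀ <;> cases r₁ <;> cases d₀ <;> cases d₁ <;> cases b <;>
  simp [ket, sign] at h ⊢ <;> nlinarith

/-- The same `d` occurs for both angles, since it is sent before `m`. Its contribution cancels in
the sum of the answers, and `r·x + r·x'` remains. -/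
theorem agreement_eq_one_of_acceptsCHSH {F : FunctionFamily} {n : ℕ} {k y r d x x' : List Bool}
    {b b' : Bool} (hne : F.preimages n k y = {x, x'}) (hr : r.length = F.inLen n)
    (hx : x.length = F.inLen n) (hx' : x'.length = F.inLen n)
    (h : AcceptsCHSH F n k y r d true b) (h' : AcceptsCHSH F n k y r d false b') :
    sign (xor (xor b b') (dot r (vxor x x'))) = 1 := by
  have key : ∀ {m b}, AcceptsCHSH F n k y r d m b →
      b = if dot r x = dot r x' then dot r x else xor (xor (dot d x) (dot d x')) (!m) := by
    rintro m b ⟨x₀, x₁, -, hp, -, hb⟩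
    have hb := eq_of_bornWeight_lt hb
    rw [hne] at hp
    -- The preimages are unordered, and the accepted bit is symmetric in them.
    rcases Set.pair_eq_pair_iff.1 hp with ⟨rfl, rfl⟩ | ⟨rfl, rfl⟩
    · exact hb
    · rw [hb]
      by_cases h : dot r x = dot r x'
      · rw [if_pos h, if_pos h.symm, h]
      · rw [if_neg h, if_neg (Ne.symm h), Bool.xor_comm (dot d x)]
  rw [dot_vxor_right hx hx' hr, key h, key h']
  cases dot r x <;> cases dot r x' <;> cases dot d x <;> cases dot d x' <;> simp [sign]

/-! ### The reduction -/

/-- The claw finder that runs the prover `A`. -/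
noncomputable def clawFinder {u : Uniformity} (A : PPT u) (Q p : Polynomial ℕ) : PPT u where
  fn v := enc (findClaw A.fn A.coins Q (dec v))
  polyTime := PT.findClaw A.polyTime A.coins Q
  -- Besides the coins of `A`, room for at most `Q + 1` blocks, each with a guessed bit and a vector
  -- of length at most `p`, when `p` bounds the input length.
  coins := A.coins + (Q + 1) * (p + 1)
  advice := A.advice
  admissible := A.admissible

theorem toStr_enc (x : List Bool) : (enc x).toStr = x := by
  rw [← dec_str, dec_enc]

theorem clawFinder_run {u : Uniformity} (A : PPT u) (Q p : Polynomial ℕ) (n : ℕ)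
    (ω k : List Bool) :
    (clawFinder A Q p).run n ω (Data.ofStr k) =
      enc (findClaw A.fn A.coins Q (List.replicate n true, A.advice n, ω, k)) := by
  have : Data.node (Data.unary n) (.node (A.advice n) (.node (Data.ofStr ω) (Data.ofStr k))) =
      enc (List.replicate n true, A.advice n, ω, k) := by
    rw [Data.unary, ← enc_str, ← enc_str, ← enc_str]
    rfl
  rw [PPT.run]
  change enc (findClaw A.fn A.coins Q (dec (Data.node _ (.node (A.advice n) _)))) = _
  rw [this, dec_enc]

theorem findClaw_append {u : Uniformity} (A : PPT u) (Q : Polynomial ℕ) (n : ℕ)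
    {ω : List Bool} (hω : ω.length = A.coins.eval n) (tape k : List Bool) :
    findClaw A.fn A.coins Q (List.replicate n true, A.advice n, ω ++ tape, k) =
      ((A.reply n ω k .preimage).toStr, vxor (A.reply n ω k .preimage).toStr
        (goldreichLevin (fun r => xor (A.reply n ω k (.third r true)).toBit
          (A.reply n ω k (.third r false)).toBit) (List.replicate (Q.eval n) true)
          (A.reply n ω k .preimage).toStr tape)) := by
  have hv : proverView A.coins (List.replicate n true, A.advice n, ω ++ tape, k) =
      (List.replicate n true, A.advice n, ω, k) := by
    simp only [proverView, List.length_replicate]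
    rw [vxor_vzero_append (by simp [hω])]
  have hx : preimageOf A.fn (List.replicate n true, A.advice n, ω, k) =
      (A.reply n ω k .preimage).toStr := by
    simp only [preimageOf, PPT.reply, PPT.run, Challenge.encode, Data.unary, enc_str]
  have hG : parityOracle A.fn (List.replicate n true, A.advice n, ω, k) =
      fun r => xor (A.reply n ω k (.third r true)).toBit
          (A.reply n ω k (.third r false)).toBit := by
    funext r
    simp only [parityOracle, PPT.reply, PPT.run, Challenge.encode, Data.unary, enc_str]
    rfl
  simp only [findClaw, hv, hx, hG, List.length_replicate]
  rw [← hω, List.drop_left]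

/-! ### The three games as sums over keys, and their comparison -/

theorem Pr_preimageGame {u : Uniformity} (F : FunctionFamily) (A : PPT u) (n : ℕ) :
    HasSum (fun k => (F.gen n k).toReal * avg (A.coins.eval n) fun ω =>
      ind ((A.reply n ω k .preimage).toStr ∈
        F.preimages n k (A.reply n ω k .start).toStr)) (pX F A n) := by
  have := hasSum_Pr_bind (F.gen n) fun k => do
    let ω ← randomStr (A.coins.eval n)
    let y := (A.reply n ω k .start).toStr
    let x := (A.reply n ω k .preimage).toStr
    return x ∈ F.preimages n k y
  simp only [Pr_randomStr_bind, Pr_pure] at this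
  exact this

theorem Pr_chshGame {u : Uniformity} (F : FunctionFamily) (A : PPT u) (n : ℕ) :
    HasSum (fun k => (F.gen n k).toReal * avg (A.coins.eval n) fun ω =>
      avg (F.inLen n) fun r =>
        (ind (AcceptsCHSH F n k (A.reply n ω k .start).toStr r (A.reply n ω k (.second r)).toStr
          true (A.reply n ω k (.third r true)).toBit) +
        ind (AcceptsCHSH F n k (A.reply n ω k .start).toStr r (A.reply n ω k (.second r)).toStr
          false (A.reply n ω k (.third r false)).toBit)) / 2) (pM F A n) := by
  have := hasSum_Pr_bind (F.gen n) fun k => do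
    let ω ← randomStr (A.coins.eval n)
    let y := (A.reply n ω k .start).toStr
    let r ← randomStr (F.inLen n)
    let d := (A.reply n ω k (.second r)).toStr
    let m ← randomBit
    let b := (A.reply n ω k (.third r m)).toBit
    return AcceptsCHSH F n k y r d m b
  simp only [Pr_randomStr_bind, Pr_randomBit_bind, Pr_pure] at this
  exact this

theorem Pr_clawGame {u : Uniformity} (F : FunctionFamily) (A : PPT u) (Q p : Polynomial ℕ)
    (n : ℕ) :
    HasSum (fun k => (F.gen n k).toReal * avg (A.coins.eval n) fun ω =>
      avg ((Q.eval n + 1) * (p.eval n + 1)) fun tape =>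
        ind (F.IsClaw n k (A.reply n ω k .preimage).toStr (vxor (A.reply n ω k .preimage).toStr
          (goldreichLevin (fun r => xor (A.reply n ω k (.third r true)).toBit
            (A.reply n ω k (.third r false)).toBit) (List.replicate (Q.eval n) true)
            (A.reply n ω k .preimage).toStr tape)))) (Pr (F.clawGame (clawFinder A Q p) n)) := by
  have := hasSum_Pr_bind (F.gen n) fun k => do
    let ω ← randomStr ((clawFinder A Q p).coins.eval n)
    let out := (clawFinder A Q p).run n ω (Data.ofStr k)
    return F.IsClaw n k out.left.toStr out.right.toStr
  have hc : (clawFinder A Q p).coins.eval n =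
      A.coins.eval n + (Q.eval n + 1) * (p.eval n + 1) := by
    simp [clawFinder]
  refine (congrArg (fun f => HasSum f _) (funext fun k => ?_)).mp this
  simp only [Pr_randomStr_bind, Pr_pure, hc, avg_append, clawFinder_run]
  congr 1
  refine avg_congr fun ω hω => avg_congr fun tape _ => ?_
  rw [findClaw_append A Q n hω]
  change ind (F.IsClaw n k (enc _).toStr (enc _).toStr) = _
  rw [toStr_enc, toStr_enc]

theorem ind_mono {p q : Prop} (h : p → q) : ind p ≤ ind q := by
  by_cases hp : p
  · rw [ind_of_true hp, ind_of_true (h hp)]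
  · rw [ind_of_false hp]
    exact ind_nonneg q

theorem exists_of_avg_pos {n : ℕ} {φ : List Bool → ℝ} (h : 0 < avg n φ) :
    ∃ v, v.length = n ∧ 0 < φ v := by
  by_contra! hφ
  exact absurd ((avg_mono hφ).trans_eq (avg_const n 0)) (not_le.2 h)

/-- For fixed coins and key: a prover that gives a preimage and wins the other game with probability
larger than `3/4` lets the Goldreich-Levin algorithm find a claw. -/
theorem accept_le_claw (F : FunctionFamily) (n : ℕ) (k y x : List Bool) (d : List Bool → List Bool)
    (b : Bool → List Bool → Bool) {u : List Bool} {θ : ℝ} {M : ℕ} (hθ : 0 < θ) (hu : u ≠ [])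
    (hN : 8 * F.inLen n ≤ u.length * θ ^ 2) (hM : (u.length + 1) * (F.inLen n + 1) ≤ M) :
    ind (x ∈ F.preimages n k y) + 4 * avg (F.inLen n) (fun r =>
        (ind (AcceptsCHSH F n k y r (d r) true (b true r)) +
          ind (AcceptsCHSH F n k y r (d r) false (b false r))) / 2) - 4 ≤
      8 * u.length * avg M (fun tape => ind (F.IsClaw n k x
        (vxor x (goldreichLevin (fun r => xor (b true r) (b false r)) u x tape)))) + θ / 2 := by
  set W := avg M fun tape => ind (F.IsClaw n k x
        (vxor x (goldreichLevin (fun r => xor (b true r) (b false r)) u x tape))) with hW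
  set A : Bool → List Bool → ℝ := fun m r => ind (AcceptsCHSH F n k y r (d r) m (b m r)) with hA
  change _ + 4 * avg _ (fun r => (A true r + A false r) / 2) - 4 ≤ _
  set P := avg (F.inLen n) fun r => (A true r + A false r) / 2 with hP
  have hW0 : 0 ≤ W := avg_nonneg fun _ _ => ind_nonneg _
  have hu' : (0 : ℝ) < u.length := by exact_mod_cast List.length_pos_iff.2 hu
  have hP1 : P ≤ 1 := (avg_mono fun r _ => by
    have h₁ : A true r ≤ 1 := ind_le_one _
    have h₂ : A false r ≤ 1 := ind_le_one _
    linarith).trans_eq (avg_const _ 1)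
  by_cases hv : ind (x ∈ F.preimages n k y) + 4 * P - 4 ≤ θ / 2
  · have : 0 ≤ 8 * u.length * W := by positivity
    linarith
  push Not at hv
  -- Without a valid preimage the excess would be at most `4 * P - 4 ≤ 0`.
  have hx : x ∈ F.preimages n k y := by
    by_contra h
    rw [ind_of_false h] at hv
    linarith
  rw [ind_of_true hx] at hv ⊢
  have hx_len := F.length_of_mem_dom n k x hx.1
  -- As `P > 0`, some transcript is accepted, and acceptance includes that `y` has exactly two
  -- preimages.
  obtain ⟨x', hne, hpre⟩ : ∃ x', x ≠ x' ∧ F.preimages n k y = {x, x'} := by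
    obtain ⟨r, -, hr⟩ := exists_of_avg_pos (show 0 < P by linarith)
    have : ∃ m, AcceptsCHSH F n k y r (d r) m (b m r) := by
      by_contra! h
      simp only [hA, ind_of_false (h _)] at hr
      norm_num at hr
    obtain ⟨m, x₀, x₁, h01, hp, -⟩ := this
    rw [hp] at hx ⊢
    rcases hx with rfl | rfl
    · exact ⟨x₁, h01, rfl⟩
    · exact ⟨x₀, h01.symm, Set.pair_comm _ _⟩
  have hx' : x' ∈ F.preimages n k y := by rw [hpre]; exact Or.inr rfl
  have hx'_len := F.length_of_mem_dom n k x' hx'.1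
  have hs_len : (vxor x x').length = F.inLen n := (length_vxor _ _).trans hx_len
  have hagree : θ / 2 ≤ avg (vxor x x').length
      (agreement (fun r => xor (b true r) (b false r)) (vxor x x')) := by
    -- The left integrand is `1` if both answers are accepted, where the agreement is `1` too, and
    -- at most `-1` otherwise.
    have h : avg (F.inLen n) (fun r => 4 * ((A true r + A false r) / 2) - 3) ≤
        avg (F.inLen n) (agreement (fun r => xor (b true r) (b false r)) (vxor x x')) := by
      refine avg_mono fun r hr => ?_
      have hge : -1 ≤ agreement (fun r => xor (b true r) (b false r)) (vxor x x') r := by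
        unfold agreement sign
        split <;> norm_num
      have h₁ : A true r ≤ 1 := ind_le_one _
      have h₂ : A false r ≤ 1 := ind_le_one _
      by_cases ht : AcceptsCHSH F n k y r (d r) true (b true r)
      · by_cases hf : AcceptsCHSH F n k y r (d r) false (b false r)
        · have : agreement (fun r => xor (b true r) (b false r)) (vxor x x') r = 1 :=
            agreement_eq_one_of_acceptsCHSH hpre hr hx_len hx'_len ht hf
          linarith
        · have : A false r = 0 := ind_of_false hf
          linarith
      · have : A true r = 0 := ind_of_false ht
        linarith
    rw [avg_sub, avg_mul, avg_const, ← hP] at h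
    rw [hs_len]
    linarith
  -- With correlation `θ / 2` the requirement `2 * ℓ ≤ u.length * (θ / 2) ^ 2` is `hN`.
  have hgl := avg_goldreichLevin_ge (x' := x) (M := M) _ (hx_len.trans hs_len.symm)
    (half_pos hθ) hagree hu
    (by rw [hs_len]; nlinarith) (by rwa [hs_len])
  have hclaw : 1 / (8 * u.length) ≤ W := hgl.trans (avg_mono fun tape _ => ind_mono fun h => by
    rw [h, vxor_vxor_cancel hx_len hx'_len]
    exact ⟨hne, hx.1, hx'.1, hx.2.trans hx'.2.symm⟩)
  rw [div_le_iff₀ (by positivity)] at hclaw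
  linarith

/-- The reduction: the excess of the prover over the classical bound is at most the success
probability of the claw finder, up to a polynomial factor and an arbitrarily small constant. -/
theorem excess_le_claw {u : Uniformity} (F : FunctionFamily) (A : PPT u) (Q p : Polynomial ℕ)
    (n : ℕ) {θ : ℝ} (hθ : 0 < θ) (hQ : 0 < Q.eval n) (hp : F.inLen n ≤ p.eval n)
    (hN : 8 * F.inLen n ≤ (Q.eval n : ℕ) * θ ^ 2) :
    pX F A n + 4 * pM F A n - 4 ≤
      8 * (Q.eval n : ℕ) * Pr (F.clawGame (clawFinder A Q p) n) + θ / 2 := by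
  have hl := ((Pr_preimageGame F A n).add ((Pr_chshGame F A n).mul_left 4)).sub
    ((hasSum_toReal (F.gen n)).mul_left 4)
  have hr := ((Pr_clawGame F A Q p n).mul_left (8 * ((Q.eval n : ℕ) : ℝ))).add
    ((hasSum_toReal (F.gen n)).mul_left (θ / 2))
  rw [mul_one] at hl hr
  refine hasSum_le (fun k => ?_) hl hr
  have hu : List.replicate (Q.eval n) true ≠ [] := by
    rw [Ne, List.replicate_eq_nil_iff]
    exact hQ.ne'
  have h := avg_mono (n := A.coins.eval n) fun ω _ => accept_le_claw F n k
    (A.reply n ω k .start).toStr (A.reply n ω k .preimage).toStr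
    (fun r => (A.reply n ω k (.second r)).toStr)
    (fun m r => (A.reply n ω k (.third r m)).toBit) (u := List.replicate (Q.eval n) true)
    (θ := θ) (M := (Q.eval n + 1) * (p.eval n + 1)) hθ hu
    (by rwa [List.length_replicate])
    (by rw [List.length_replicate]; gcongr)
  rw [avg_sub, avg_add, avg_add, avg_mul, avg_mul, avg_const, avg_const,
    List.length_replicate] at h
  have := mul_le_mul_of_nonneg_left h (ENNReal.toReal_nonneg (a := F.gen n k))
  linarith

/-- The negligible function may depend on the exponent: for the decay of `n ^ c * δ n` only the
bound with exponent `c + 1` is used, and its error term becomes `1 / n`. -/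
theorem negligible_of_le {δ : ℕ → ℝ} (h₀ : ∀ n, 0 ≤ δ n)
    (h : ∀ c : ℕ, ∃ ε, Negligible ε ∧ ∀ n : ℕ, 0 < n → δ n ≤ ε n + 1 / (n : ℝ) ^ c) :
    Negligible δ := by
  intro c
  obtain ⟨ε, hε, hδ⟩ := h (c + 1)
  have hlim := (hε c).add (tendsto_one_div_atTop_nhds_zero_nat (𝕜 := ℝ))
  rw [add_zero] at hlim
  refine tendsto_of_tendsto_of_tendsto_of_le_of_le' tendsto_const_nhds hlim
    (Filter.Eventually.of_forall fun n => mul_nonneg (by positivity) (h₀ n)) ?_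
  filter_upwards [Filter.eventually_gt_atTop 0] with n hn
  have hn' : (0 : ℝ) < n := by exact_mod_cast hn
  calc (n : ℝ) ^ c * δ n ≤ n ^ c * (ε n + 1 / (n : ℝ) ^ (c + 1)) := by
        gcongr
        exact hδ n hn
    _ = n ^ c * ε n + 1 / n := by
        field_simp
        ring

theorem Negligible.eval_mul {ε : ℕ → ℝ} (hε : Negligible ε) (Q : Polynomial ℕ) :
    Negligible fun n => ((Q.eval n : ℕ) : ℝ) * ε n := by
  have := Asymptotics.SuperpolynomialDecay.polynomial_mul hε (Q.map (Nat.castRingHom ℝ))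
  simp only [Polynomial.eval_natCast_map, eq_natCast] at this
  exact this

end TCFProtocol

/-- If the function family is claw-free, then for every classical (probabilistic polynomial-time)
prover `p_x + 4 p_m - 4` is less than a negligible function; both for uniform adversaries and for
non-uniform ones. -/
theorem theorem2 (u : TCFProtocol.Uniformity) (F : TCFProtocol.FunctionFamily)
    (hF : F.ClawFree u) (A : TCFProtocol.PPT u) :
    ∃ ε : ℕ → ℝ, TCFProtocol.Negligible ε ∧
      ∀ n : ℕ, TCFProtocol.pX F A n + 4 * TCFProtocol.pM F A n - 4 < ε n := by
  open TCFProtocol in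
  obtain ⟨p, hp⟩ := F.inLen_le
  -- Any machine would do as claw finder here: its strict bound is a positive negligible function,
  -- which makes the final inequality strict.
  obtain ⟨ε₀, hε₀, hpos⟩ := hF A
  have hpos : ∀ n, 0 < ε₀ n := fun n => (Pr_nonneg _).trans_lt (hpos n)
  -- The excess itself may be far below zero, so only its positive part is negligible.
  have hδ : Negligible fun n => max (pX F A n + 4 * pM F A n - 4) 0 := by
    refine negligible_of_le (fun n => le_max_right _ _) fun c => ?_
    -- Chosen so that `8 * p ≤ Q * θ ^ 2` for `θ = 1 / n ^ c`; the `1` keeps `Q` positive.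
    let Q : Polynomial ℕ := 8 * p * Polynomial.X ^ (2 * c) + 1
    obtain ⟨ε, hε, hB⟩ := hF (clawFinder A Q p)
    refine ⟨_, hε.eval_mul (8 * Q), fun n hn => ?_⟩
    have hn' : (0 : ℝ) < n := by exact_mod_cast hn
    have hQ : Q.eval n = 8 * p.eval n * n ^ (2 * c) + 1 := by simp [Q]
    have h := excess_le_claw F A Q p n (θ := 1 / (n : ℝ) ^ c) (by positivity) (by omega) (hp n) (by
      have hp' : (F.inLen n : ℝ) ≤ (p.eval n : ℕ) := by exact_mod_cast hp n
      rw [hQ]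
      push_cast
      have : (8 * ((p.eval n : ℕ) : ℝ) * n ^ (2 * c) + 1) * (1 / (n : ℝ) ^ c) ^ 2 =
          8 * (p.eval n : ℕ) + (1 / (n : ℝ) ^ c) ^ 2 := by
        rw [mul_comm 2 c, pow_mul]
        field_simp
      rw [this]
      nlinarith [sq_nonneg (1 / (n : ℝ) ^ c)])
    have h₁ := mul_le_mul_of_nonneg_left (hB n).le
      (show (0 : ℝ) ≤ 8 * (Q.eval n : ℕ) by positivity)
    have h₂ := mul_nonneg (show (0 : ℝ) ≤ 8 * (Q.eval n : ℕ) by positivity)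
      ((Pr_nonneg _).trans (hB n).le)
    have h₃ : (0 : ℝ) < 1 / (n : ℝ) ^ c := by positivity
    have h₄ : (((8 * Q).eval n : ℕ) : ℝ) = 8 * (Q.eval n : ℕ) := by simp
    rw [h₄]
    exact max_le (by linarith) (by linarith)
  exact ⟨_, hδ.add hε₀, fun n => by
    have := le_max_left (pX F A n + 4 * pM F A n - 4) 0
    have := hpos n
    simp only [Pi.add_apply]
    linarith⟩
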